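/- **Setting.** Let $\square=[-\pi,\pi)^2$, $\square^*=[-\tfrac12,\tfrac12)^2$, $\epsilon_0>1$, $\gamma=\epsilon_0-1$, and let $R\subset\mathbb R^2$ be open with $\overline R\subset\square$. Let $\epsilon(x_1,x_2)=\epsilon_0$ if $(x_1,x_2)\in\bigcup_{z\in\mathbb Z^2}(R+2\pi z)$ and $\epsilon=1$ otherwise. A function $f$ on $\mathbb R^2$ is $\theta$-quasi-periodic if $f(y+2\pi e_j)=e^{2\pi \mathrm i\theta_j}f(y)$, $j=1,2$, i.e. if it is $e^{\mathrm i\theta\cdot y}$ times a $\square$-periodic function. Let $H^1_\theta(\square;\mathbb C^2)$ be the Sobolev space of $\theta$-quasi-periodic $H^1$ vector fields. Write $\operatorname{div}u=u_{1,1}+u_{2,2}$, $\operatorname{curl}u=u_{2,1}-u_{1,2}$, $\nabla^\perp p=(-p_{,2},p_{,1})$ and $$V(\theta)=\{v\in H^1_\theta(\square;\mathbb C^2)\;:\;\operatorname{div}v=\operatorname{curl}v=0\ \text{a.e. in }\square\setminus R\},$$ $$b(u,\phi)=-\tfrac12\int_{\square\setminus R}\big(\nabla^\perp u_1\cdot\overline{\nabla\phi_2}+\nabla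 u_2\cdot\overline{\nabla^\perp\phi_1}\big)+\tfrac1\gamma\int_R\big(\nabla u_1\cdot\overline{\nabla\phi_1}+\epsilon_0\nabla u_2\cdot\overline{\nabla\phi_2}+\nabla^\perp u_1\cdot\overline{\nabla\phi_2}+\nabla u_2\cdot\overline{\nabla^\perp\phi_1}\big),$$ $$c(u,\phi)=\int_\square u\cdot\overline\phi+\gamma\int_R u_2\overline{\phi_2}.$$ Let $\mathcal H$ be the closure of $V(\theta)$ in $L^2(\square;\mathbb C^2)$, with inner product $c$, and let $\mathcal B(\theta)$ be the operator in $\mathcal H$ generated by the form $b$ with form domain $V(\theta)$: $v\in\operatorname{dom}\mathcal B(\theta)$ and $\mathcal B(\theta)v=h$ if and only if $v\in V(\theta)$, $h\in\mathcal H$ and $b(v,\phi)=c(h,\phi)$ for all $\phi\in V(\theta)$. **Lemma.** Let $\theta\in\square^*$ and $\omega\in\mathbb R$, and let $(\omega^2,v)$ be an eigenvalue-eigenfunction pair of $\mathcal B(\theta)$ (so $0\ne v\in\operatorname{dom}\mathcal B(\theta)$ and $\mathcal B(\theta)v=\omega^2v$). Then there exist $\theta$-quasi-periodic amplitudes $E,H\in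 L^2_{\mathrm{loc}}(\mathbb R^2;\mathbb C^3)$ with $(H_3,E_3)=v$ a.e. in $\square$ such that the waves $$\tilde E(x_1,x_2,x_3,t)=e^{\mathrm i\omega(x_3-t)}E(x_1,x_2),\qquad \tilde H(x_1,x_2,x_3,t)=e^{\mathrm i\omega(x_3-t)}H(x_1,x_2)$$ (that is, wave number $\omega k$ with $k=1$) solve the Maxwell system $$\nabla\times\tilde H=-\epsilon\,\partial_t\tilde E,\qquad \nabla\times\tilde E=\partial_t\tilde H$$ in the sense of distributions on $\mathbb R^3\times\mathbb R$. -/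

import Mathlib

open MeasureTheory Set
open scoped ComplexConjugate

noncomputable section

namespace PCF

/-! ### The periodic cell and quasi-periodic functions -/

/-- The cross-sectional plane, with coordinates `(y₁, y₂)`. -/
abbrev Plane : Type := ℝ × ℝ

/-- The periodicity cell `□ = [-π, π)²`. -/
def cell : Set Plane := Ico (-Real.pi) Real.pi ×ˢ Ico (-Real.pi) Real.pi

/-- The dual cell `□* = [-1/2, 1/2)²`. -/
def dualCell : Set Plane := Ico (-(1 / 2)) (1 / 2) ×ˢ Ico (-(1 / 2)) (1 / 2)

/-- `θ`-quasi-periodicity: `f` is `exp (i θ · y)` times a `2π`-periodic function. -/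
def QuasiPeriodic {F : Type*} [AddCommGroup F] [Module ℂ F] (θ : Plane) (f : Plane → F) : Prop :=
  ∀ y : Plane,
    f (y + (2 * Real.pi, 0)) = Complex.exp (2 * Real.pi * Complex.I * θ.1) • f y ∧
    f (y + (0, 2 * Real.pi)) = Complex.exp (2 * Real.pi * Complex.I * θ.2) • f y

/-- The coordinate directions of the plane. -/
def axis : Fin 2 → Plane := ![(1, 0), (0, 1)]

/-! ### The spaces `L²(□; ℂ²)` and `H¹_θ(□; ℂ²)` -/

/-- `L²(□; ℂ²)`. -/
abbrev L2 : Type := Lp (EuclideanSpace ℂ (Fin 2)) 2 (volume.restrict cell)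

/-- `g ∈ L²(□; ℂ²)` is the weak `j`-th partial derivative of the `θ`-quasi-periodic vector field
`u ∈ L²(□; ℂ²)`. Testing against all smooth `θ`-quasi-periodic functions (and not only against
those supported inside the cell) says that the quasi-periodic extension of `u` to the plane is
weakly differentiable across the boundary of the cell. -/
def HasPartial (θ : Plane) (j : Fin 2) (u g : L2) : Prop :=
  ∀ φ : Plane → ℂ, ContDiff ℝ (⊤ : ℕ∞) φ → QuasiPeriodic θ φ → ∀ i : Fin 2,
    ∫ y in cell, u y i * conj (fderiv ℝ φ y (axis j)) = -∫ y in cell, g y i * conj (φ y)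

/-- The weak partial derivative `u_{,j}` (and `0` if there is none); it is unique by
`HasPartial.unique`. -/
def partialD (θ : Plane) (j : Fin 2) (u : L2) : L2 :=
  open Classical in if h : ∃ g, HasPartial θ j u g then h.choose else 0

lemma measurableSet_cell : MeasurableSet cell := measurableSet_Ico.prod measurableSet_Ico

lemma memLp_coord (u : L2) (i : Fin 2) : MemLp (fun y => u y i) 2 (volume.restrict cell) := by
  have h := Lp.memLp u
  exact ((EuclideanSpace.proj (𝕜 := ℂ) i).comp_memLp' h)

lemma integrable_mul_conj {f g : Plane → ℂ} {μ : Measure Plane}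
    (hf : MemLp f 2 μ) (hg : MemLp g 2 μ) : Integrable (fun y => f y * conj (g y)) μ :=
  hf.integrable_mul hg.star

instance : IsFiniteMeasure ((volume : Measure Plane).restrict cell) := by
  refine ⟨?_⟩
  rw [Measure.restrict_apply_univ]
  refine lt_of_le_of_lt (measure_mono (t := Icc (-Real.pi) Real.pi ×ˢ Icc (-Real.pi) Real.pi) ?_)
    (isCompact_Icc.prod isCompact_Icc).measure_lt_top
  exact prod_mono Ico_subset_Icc_self Ico_subset_Icc_self

lemma memLp_of_continuous {f : Plane → ℂ} (hf : Continuous f) :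
    MemLp f 2 (volume.restrict cell) := by
  have hK : IsCompact (Icc (-Real.pi) Real.pi ×ˢ Icc (-Real.pi) Real.pi : Set Plane) :=
    isCompact_Icc.prod isCompact_Icc
  obtain ⟨C, hC⟩ := hK.exists_bound_of_continuousOn hf.continuousOn
  refine MemLp.of_bound hf.aestronglyMeasurable C ?_
  refine (ae_restrict_iff' measurableSet_cell).2 (Filter.Eventually.of_forall fun y hy => hC y ?_)
  exact prod_mono Ico_subset_Icc_self Ico_subset_Icc_self hy

lemma coord_add (u v : L2) (i : Fin 2) :
    (fun y => (u + v) y i) =ᵐ[volume.restrict cell] fun y => u y i + v y i := by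
  filter_upwards [Lp.coeFn_add u v] with y hy
  exact congrArg (fun w : EuclideanSpace ℂ (Fin 2) => w i) hy

lemma coord_smul (a : ℂ) (u : L2) (i : Fin 2) :
    (fun y => (a • u) y i) =ᵐ[volume.restrict cell] fun y => a * u y i := by
  filter_upwards [Lp.coeFn_smul a u] with y hy
  simp [hy]

lemma coord_zero (i : Fin 2) :
    (fun y => (0 : L2) y i) =ᵐ[volume.restrict cell] fun _ => 0 := by
  filter_upwards [Lp.coeFn_zero (EuclideanSpace ℂ (Fin 2)) 2 (volume.restrict cell)] with y hy
  exact congrArg (fun w : EuclideanSpace ℂ (Fin 2) => w i) hy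

/-- The pairing of a component of an `L²` field with a function. -/
def pair (i : Fin 2) (w : Plane → ℂ) (u : L2) : ℂ := ∫ y in cell, u y i * conj (w y)

lemma pair_add (i : Fin 2) {w : Plane → ℂ} (hw : MemLp w 2 (volume.restrict cell)) (u v : L2) :
    pair i w (u + v) = pair i w u + pair i w v := by
  unfold pair
  rw [← integral_add (integrable_mul_conj (memLp_coord u i) hw)
    (integrable_mul_conj (memLp_coord v i) hw)]
  refine integral_congr_ae ?_
  filter_upwards [coord_add u v i] with y hy
  rw [hy, add_mul]

lemma pair_smul (i : Fin 2) (w : Plane → ℂ) (a : ℂ) (u : L2) :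
    pair i w (a • u) = a * pair i w u := by
  unfold pair
  rw [← integral_const_mul]
  refine integral_congr_ae ?_
  filter_upwards [coord_smul a u i] with y hy
  rw [hy, mul_assoc]

lemma memLp_fderiv {φ : Plane → ℂ} (hφ : ContDiff ℝ (⊤ : ℕ∞) φ) (e : Plane) :
    MemLp (fun y => fderiv ℝ φ y e) 2 (volume.restrict cell) :=
  memLp_of_continuous ((hφ.continuous_fderiv (by simp)).clm_apply continuous_const)

lemma HasPartial.add {θ : Plane} {j : Fin 2} {u g u' g' : L2} (h : HasPartial θ j u g)
    (h' : HasPartial θ j u' g') : HasPartial θ j (u + u') (g + g') := by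
  intro φ hφ hq i
  have h1 := h φ hφ hq i
  have h2 := h' φ hφ hq i
  have e1 := pair_add i (memLp_fderiv hφ (axis j)) u u'
  have e2 := pair_add i (memLp_of_continuous hφ.continuous) g g'
  unfold pair at e1 e2
  rw [e1, e2, h1, h2]; ring

lemma HasPartial.smul {θ : Plane} {j : Fin 2} {u g : L2} (a : ℂ) (h : HasPartial θ j u g) :
    HasPartial θ j (a • u) (a • g) := by
  intro φ hφ hq i
  have h1 := h φ hφ hq i
  have e1 := pair_smul i (fun y => fderiv ℝ φ y (axis j)) a u
  have e2 := pair_smul i φ a g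
  unfold pair at e1 e2
  rw [e1, e2, h1]; ring

lemma HasPartial.zero (θ : Plane) (j : Fin 2) : HasPartial θ j 0 0 := by
  intro φ _ _ i
  have e1 := pair_smul i (fun y => fderiv ℝ φ y (axis j)) 0 0
  have e2 := pair_smul i φ 0 0
  unfold pair at e1 e2
  rw [zero_smul, zero_mul] at e1 e2
  rw [e1, e2, neg_zero]

/-! Uniqueness of weak derivatives, by periodising bump functions. -/

/-- The quasi-periodisation of a compactly supported function. -/
def periodize (θ : Plane) (ψ : Plane → ℂ) (y : Plane) : ℂ :=
  ∑ᶠ z : ℤ × ℤ, Complex.exp (-(2 * Real.pi * Complex.I * (θ.1 * z.1 + θ.2 * z.2))) *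
    ψ (y + (2 * Real.pi * z.1, 2 * Real.pi * z.2))

lemma locallyFinite_translates {ψ : Plane → ℂ} (hc : HasCompactSupport ψ) (c : ℤ × ℤ → ℂ) :
    LocallyFinite fun z : ℤ × ℤ => Function.support
      fun y : Plane => c z * ψ (y + (2 * Real.pi * z.1, 2 * Real.pi * z.2)) := by
  obtain ⟨M, hM⟩ := hc.isCompact.isBounded.exists_norm_le
  intro y0
  refine ⟨Metric.ball y0 1, Metric.ball_mem_nhds y0 one_pos, ?_⟩
  obtain ⟨N, hN⟩ := exists_nat_gt (M + ‖y0‖ + 1)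
  refine ((Set.finite_Icc (-(N : ℤ)) N).prod (Set.finite_Icc (-(N : ℤ)) N)).subset ?_
  rintro z ⟨y, hy, hyb⟩
  have hne : ψ (y + (2 * Real.pi * z.1, 2 * Real.pi * z.2)) ≠ 0 := fun h => hy (by simp [h])
  have h1 := hM _ (subset_tsupport ψ hne)
  have h2 : ‖y‖ ≤ ‖y0‖ + 1 := by
    have := norm_sub_norm_le y y0
    rw [Metric.mem_ball, dist_eq_norm] at hyb
    linarith
  have h3 : ‖((2 * Real.pi * z.1, 2 * Real.pi * z.2) : Plane)‖ ≤ M + ‖y0‖ + 1 := by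
    have := norm_sub_le (y + (2 * Real.pi * z.1, 2 * Real.pi * z.2)) y
    rw [add_sub_cancel_left] at this
    linarith
  have key : ∀ m : ℤ, |2 * Real.pi * (m : ℝ)| ≤ M + ‖y0‖ + 1 → m ∈ Set.Icc (-(N : ℤ)) N := by
    intro m hm
    have hpi := Real.pi_gt_three
    rw [abs_mul, abs_of_pos (by positivity : (0 : ℝ) < 2 * Real.pi)] at hm
    have h4 : |(m : ℝ)| ≤ N := by nlinarith [abs_nonneg (m : ℝ)]
    rw [abs_le] at h4
    exact ⟨by exact_mod_cast h4.1, by exact_mod_cast h4.2⟩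
  rw [Prod.norm_def, max_le_iff] at h3
  exact ⟨key _ h3.1, key _ h3.2⟩

lemma contDiff_periodize (θ : Plane) {ψ : Plane → ℂ} (hψ : ContDiff ℝ (⊤ : ℕ∞) ψ)
    (hc : HasCompactSupport ψ) : ContDiff ℝ (⊤ : ℕ∞) (periodize θ ψ) := by
  have hlf := locallyFinite_translates hc
    fun z => Complex.exp (-(2 * Real.pi * Complex.I * (θ.1 * z.1 + θ.2 * z.2)))
  rw [contDiff_iff_contDiffAt]
  intro y0
  obtain ⟨s, hs⟩ := finsum_eventually_eq_sum hlf y0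
  refine ContDiffAt.congr_of_eventuallyEq ?_ hs
  refine ContDiffAt.sum fun z _ => ?_
  exact (contDiff_const.mul (hψ.comp (contDiff_id.add contDiff_const))).contDiffAt

lemma quasiPeriodic_periodize (θ : Plane) (ψ : Plane → ℂ) :
    QuasiPeriodic θ (periodize θ ψ) := by
  intro y
  constructor
  · unfold periodize
    rw [smul_finsum,
      ← finsum_comp_equiv (Equiv.addRight ((-1, 0) : ℤ × ℤ))]
    refine finsum_congr fun z => ?_
    simp only [Equiv.coe_addRight, Prod.fst_add, Prod.snd_add, smul_eq_mul]
    rw [← mul_assoc, ← Complex.exp_add]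
    congr 2
    · push_cast; ring
    · ext
      all_goals simp
      ring
  · unfold periodize
    rw [smul_finsum,
      ← finsum_comp_equiv (Equiv.addRight ((0, -1) : ℤ × ℤ))]
    refine finsum_congr fun z => ?_
    simp only [Equiv.coe_addRight, Prod.fst_add, Prod.snd_add, smul_eq_mul]
    rw [← mul_assoc, ← Complex.exp_add]
    congr 2
    · push_cast; ring
    · ext
      all_goals simp
      ring

lemma periodize_eq (θ : Plane) {ψ : Plane → ℂ} (hs : Function.support ψ ⊆ cell) {y : Plane}
    (hy : y ∈ cell) : periodize θ ψ y = ψ y := by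
  unfold periodize
  rw [finsum_eq_single _ (0 : ℤ × ℤ)]
  · have h0 : ((0, 0) : Plane) = 0 := rfl
    simp [h0]
  · intro z hz
    by_contra hne
    apply hz
    have hmem : y + (2 * Real.pi * z.1, 2 * Real.pi * z.2) ∈ cell :=
      hs fun h => hne (by rw [h, mul_zero])
    have hpi := Real.pi_pos
    have key : ∀ (t : ℝ) (m : ℤ), t ∈ Ico (-Real.pi) Real.pi →
        t + 2 * Real.pi * m ∈ Ico (-Real.pi) Real.pi → m = 0 := by
      intro t m h1 h2
      have ha : (m : ℝ) < 1 := by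
        by_contra hcon
        have := mul_le_mul_of_nonneg_left (not_lt.1 hcon) hpi.le
        linarith [h1.1, h2.2]
      have hb : (-1 : ℝ) < m := by
        by_contra hcon
        have := mul_le_mul_of_nonneg_left (not_lt.1 hcon) hpi.le
        linarith [h1.2, h2.1]
      have ha' : m < 1 := by exact_mod_cast ha
      have hb' : -1 < m := by exact_mod_cast hb
      omega
    exact Prod.ext (key _ _ hy.1 hmem.1) (key _ _ hy.2 hmem.2)

lemma eq_zero_of_pair {θ : Plane} {g : L2}
    (h : ∀ φ : Plane → ℂ, ContDiff ℝ (⊤ : ℕ∞) φ → QuasiPeriodic θ φ → ∀ i : Fin 2,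
      ∫ y in cell, g y i * conj (φ y) = 0) : g = 0 := by
  have hU : IsOpen (Ioo (-Real.pi) Real.pi ×ˢ Ioo (-Real.pi) Real.pi : Set Plane) :=
    isOpen_Ioo.prod isOpen_Ioo
  have hUc : (Ioo (-Real.pi) Real.pi ×ˢ Ioo (-Real.pi) Real.pi : Set Plane) ⊆ cell :=
    prod_mono Ioo_subset_Ico_self Ioo_subset_Ico_self
  have hae : (Ioo (-Real.pi) Real.pi ×ˢ Ioo (-Real.pi) Real.pi : Set Plane)
      =ᵐ[volume] cell := by
    exact Measure.set_prod_ae_eq Ioo_ae_eq_Ico Ioo_ae_eq_Ico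
  have hcoord : ∀ i : Fin 2, ∀ᵐ y ∂volume.restrict cell, g y i = 0 := by
    intro i
    suffices hsuf : ∀ᵐ y ∂volume, y ∈ (Ioo (-Real.pi) Real.pi ×ˢ Ioo (-Real.pi) Real.pi : Set Plane)
        → g y i = 0 by
      rw [ae_restrict_iff' measurableSet_cell]
      filter_upwards [hsuf, hae.mem_iff] with y hy hm hc
      exact hy (hm.2 hc)
    refine hU.ae_eq_zero_of_integral_contDiff_smul_eq_zero ?_ ?_
    · have hint : Integrable (fun y => g y i) (volume.restrict cell) :=
        (memLp_coord g i).integrable (by norm_num)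
      exact (IntegrableOn.mono_set hint hUc).locallyIntegrableOn
    · intro ψ hψ hc hs
      have hψ' : ContDiff ℝ (⊤ : ℕ∞) fun y => (ψ y : ℂ) := Complex.ofRealCLM.contDiff.comp hψ
      have hc' : HasCompactSupport fun y => (ψ y : ℂ) := hc.comp_left Complex.ofReal_zero
      have hs' : Function.support (fun y => (ψ y : ℂ)) ⊆ cell := by
        intro y hy
        exact hUc (hs (subset_tsupport ψ fun h0 => hy (by simp [h0])))
      have h1 := h _ (contDiff_periodize θ hψ' hc') (quasiPeriodic_periodize θ _) i
      rw [← h1, ← setIntegral_eq_integral_of_forall_compl_eq_zero (s := cell)]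
      · refine setIntegral_congr_fun measurableSet_cell fun y hy => ?_
        simp only [periodize_eq θ hs' hy, Complex.conj_ofReal, Complex.real_smul]
        ring
      · intro y hy
        have : ψ y = 0 := by
          by_contra h0
          exact hy (hs' (by simpa using h0))
        simp [this]
  refine Lp.ext ?_
  filter_upwards [hcoord 0, hcoord 1,
    Lp.coeFn_zero (EuclideanSpace ℂ (Fin 2)) 2 (volume.restrict cell)] with y h0 h1 hz
  rw [hz]
  ext i
  fin_cases i
  · simpa using h0
  · simpa using h1

lemma HasPartial.unique {θ : Plane} {j : Fin 2} {u g g' : L2} (h : HasPartial θ j u g)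
    (h' : HasPartial θ j u g') : g = g' := by
  rw [← sub_eq_zero]
  refine eq_zero_of_pair (θ := θ) fun φ hφ hq i => ?_
  have h2 : HasPartial θ j 0 (g - g') := by
    have := h.add (h'.smul (-1))
    simpa [sub_eq_add_neg] using this
  have h3 := h2 φ hφ hq i
  have h4 := HasPartial.zero θ j φ hφ hq i
  have e := pair_smul i φ 0 0
  unfold pair at e
  rw [zero_smul, zero_mul] at e
  rw [h4, e] at h3
  simpa using h3.symm

lemma partialD_eq {θ : Plane} {j : Fin 2} {u g : L2} (h : HasPartial θ j u g) :
    partialD θ j u = g := by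
  have hex : ∃ g, HasPartial θ j u g := ⟨g, h⟩
  unfold partialD
  rw [dif_pos hex]
  exact hex.choose_spec.unique h

/-- The Sobolev space `H¹_θ(□; ℂ²)` of `θ`-quasi-periodic vector fields. -/
def H1 (θ : Plane) : Submodule ℂ L2 where
  carrier := {u | ∀ j, ∃ g, HasPartial θ j u g}
  add_mem' hu hv j := by
    obtain ⟨g, hg⟩ := hu j
    obtain ⟨g', hg'⟩ := hv j
    exact ⟨_, hg.add hg'⟩
  zero_mem' j := ⟨0, HasPartial.zero θ j⟩
  smul_mem' a u hu j := by
    obtain ⟨g, hg⟩ := hu j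
    exact ⟨_, hg.smul a⟩

lemma hasPartial_partialD {θ : Plane} {u : L2} (hu : u ∈ H1 θ) (j : Fin 2) :
    HasPartial θ j u (partialD θ j u) := by
  obtain ⟨g, hg⟩ := hu j
  rwa [partialD_eq hg]

lemma partialD_add {θ : Plane} {u v : L2} (hu : u ∈ H1 θ) (hv : v ∈ H1 θ) (j : Fin 2) :
    partialD θ j (u + v) = partialD θ j u + partialD θ j v :=
  partialD_eq ((hasPartial_partialD hu j).add (hasPartial_partialD hv j))

lemma partialD_smul {θ : Plane} {u : L2} (a : ℂ) (hu : u ∈ H1 θ) (j : Fin 2) :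
    partialD θ j (a • u) = a • partialD θ j u :=
  partialD_eq ((hasPartial_partialD hu j).smul a)

lemma partialD_zero (θ : Plane) (j : Fin 2) : partialD θ j 0 = 0 :=
  partialD_eq (HasPartial.zero θ j)

/-- The gradient `∇ uᵢ = (u_{i,1}, u_{i,2})` of the `i`-th component of `u`. -/
def grad (θ : Plane) (u : L2) (i : Fin 2) (y : Plane) : Fin 2 → ℂ := fun j => partialD θ j u y i

/-- `div u = u_{1,1} + u_{2,2}`. -/
def div (θ : Plane) (u : L2) (y : Plane) : ℂ := grad θ u 0 y 0 + grad θ u 1 y 1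

/-- `curl u = u_{2,1} - u_{1,2}`. -/
def curl (θ : Plane) (u : L2) (y : Plane) : ℂ := grad θ u 1 y 0 - grad θ u 0 y 1

/-- Rotation by `π/2`: `(p₁, p₂) ↦ (-p₂, p₁)`, so that `perp (∇ f) = ∇^⊥ f`. -/
def perp (p : Fin 2 → ℂ) : Fin 2 → ℂ := ![-p 1, p 0]

/-- `p · q̄`. -/
def cdot (p q : Fin 2 → ℂ) : ℂ := ∑ j, p j * conj (q j)

/-! ### The photonic crystal fibre, the forms and the operator -/

/-- The data of the fibre: the permittivity `ε₀ > 1` of the inclusions and the open cross-section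
`R` of the inclusion in the periodicity cell. -/
structure Fibre where
  ε₀ : ℝ
  R : Set Plane
  one_lt : 1 < ε₀
  isOpen : IsOpen R
  closure_subset : closure R ⊆ cell

namespace Fibre

/-- `γ = ε₀ - 1`. -/
def γ (P : Fibre) : ℝ := P.ε₀ - 1

/-- `V(θ)`: the fields `v ∈ H¹_θ(□; ℂ²)` with `div v = 0` and `curl v = 0` in `□ \ R`. -/
def V (P : Fibre) (θ : Plane) : Submodule ℂ L2 where
  carrier := {v | v ∈ H1 θ ∧
    ∀ᵐ y ∂volume.restrict (cell \ P.R), div θ v y = 0 ∧ curl θ v y = 0}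
  add_mem' := by
    rintro u v ⟨hu, hu'⟩ ⟨hv, hv'⟩
    refine ⟨add_mem hu hv, ?_⟩
    have hle : volume.restrict (cell \ P.R) ≤ volume.restrict cell :=
      Measure.restrict_mono sdiff_subset le_rfl
    filter_upwards [hu', hv',
      ae_mono hle (coord_add (partialD θ 0 u) (partialD θ 0 v) 0),
      ae_mono hle (coord_add (partialD θ 0 u) (partialD θ 0 v) 1),
      ae_mono hle (coord_add (partialD θ 1 u) (partialD θ 1 v) 0),
      ae_mono hle (coord_add (partialD θ 1 u) (partialD θ 1 v) 1)] with y h1 h2 h3 h4 h5 h6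
    simp only [div, curl, grad] at h1 h2 ⊢
    simp only [partialD_add hu hv, h3, h4, h5, h6]
    constructor
    · linear_combination h1.1 + h2.1
    · linear_combination h1.2 + h2.2
  zero_mem' := by
    refine ⟨zero_mem _, ?_⟩
    have hle : volume.restrict (cell \ P.R) ≤ volume.restrict cell :=
      Measure.restrict_mono sdiff_subset le_rfl
    filter_upwards [ae_mono hle (coord_zero 0), ae_mono hle (coord_zero 1)] with y h0 h1
    simp only [div, curl, grad, partialD_zero, h0, h1]
    simp
  smul_mem' := by
    rintro a u ⟨hu, hu'⟩
    refine ⟨Submodule.smul_mem _ a hu, ?_⟩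
    have hle : volume.restrict (cell \ P.R) ≤ volume.restrict cell :=
      Measure.restrict_mono sdiff_subset le_rfl
    filter_upwards [hu',
      ae_mono hle (coord_smul a (partialD θ 0 u) 0),
      ae_mono hle (coord_smul a (partialD θ 0 u) 1),
      ae_mono hle (coord_smul a (partialD θ 1 u) 0),
      ae_mono hle (coord_smul a (partialD θ 1 u) 1)] with y h1 h3 h4 h5 h6
    simp only [div, curl, grad] at h1 ⊢
    simp only [partialD_smul a hu, h3, h4, h5, h6]
    constructor
    · linear_combination a * h1.1
    · linear_combination a * h1.2

/-- The sesquilinear form `b`. -/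
def b (P : Fibre) (θ : Plane) (u φ : L2) : ℂ :=
  -(1 / 2) * (∫ y in cell \ P.R,
      (cdot (perp (grad θ u 0 y)) (grad θ φ 1 y) + cdot (grad θ u 1 y) (perp (grad θ φ 0 y)))) +
  (1 / P.γ) * ∫ y in P.R,
      (cdot (grad θ u 0 y) (grad θ φ 0 y) + P.ε₀ * cdot (grad θ u 1 y) (grad θ φ 1 y) +
        cdot (perp (grad θ u 0 y)) (grad θ φ 1 y) + cdot (grad θ u 1 y) (perp (grad θ φ 0 y)))

/-- The sesquilinear form `c`, an inner product on `L²(□; ℂ²)` equivalent to the standard one. -/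
def c (P : Fibre) (u φ : L2) : ℂ :=
  (∫ y in cell, cdot (u y) (φ y)) + P.γ * ∫ y in P.R, u y 1 * conj (φ y 1)

lemma R_subset (P : Fibre) : P.R ⊆ cell := subset_closure.trans P.closure_subset

lemma memLp_grad (θ : Plane) (u : L2) (i j : Fin 2) {S : Set Plane} (hS : S ⊆ cell) :
    MemLp (fun y => grad θ u i y j) 2 (volume.restrict S) :=
  (memLp_coord (partialD θ j u) i).mono_measure (Measure.restrict_mono hS le_rfl)

/-- The bilinear combinations of derivatives occurring in `b`. -/
lemma integrable_grad (θ : Plane) (u φ : L2) (i j i' j' : Fin 2) {S : Set Plane} (hS : S ⊆ cell) :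
    Integrable (fun y => grad θ u i y j * conj (grad θ φ i' y j')) (volume.restrict S) :=
  integrable_mul_conj (memLp_grad θ u i j hS) (memLp_grad θ φ i' j' hS)

lemma integrable_cross (θ : Plane) (u φ : L2) {S : Set Plane} (hS : S ⊆ cell) :
    Integrable (fun y => cdot (perp (grad θ u 0 y)) (grad θ φ 1 y) +
      cdot (grad θ u 1 y) (perp (grad θ φ 0 y))) (volume.restrict S) := by
  have I := fun i j i' j' => integrable_grad θ u φ i j i' j' hS
  have := (((I 0 0 1 1).sub (I 0 1 1 0)).add (I 1 1 0 0)).sub (I 1 0 0 1)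
  refine this.congr (Filter.Eventually.of_forall fun y => ?_)
  simp [cdot, perp, Fin.sum_univ_two]
  ring

lemma integrable_inner (P : Fibre) (θ : Plane) (u φ : L2) :
    Integrable (fun y => cdot (grad θ u 0 y) (grad θ φ 0 y) +
        P.ε₀ * cdot (grad θ u 1 y) (grad θ φ 1 y) +
        cdot (perp (grad θ u 0 y)) (grad θ φ 1 y) + cdot (grad θ u 1 y) (perp (grad θ φ 0 y)))
      (volume.restrict P.R) := by
  have I := fun i j i' j' => integrable_grad θ u φ i j i' j' P.R_subset
  have := (((I 0 0 0 0).add (I 0 1 0 1)).add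
    (((I 1 0 1 0).add (I 1 1 1 1)).const_mul (P.ε₀ : ℂ))).add (integrable_cross θ u φ P.R_subset)
  refine this.congr (Filter.Eventually.of_forall fun y => ?_)
  simp [cdot, perp, Fin.sum_univ_two]
  ring

lemma grad_add {θ : Plane} {u v : L2} (hu : u ∈ H1 θ) (hv : v ∈ H1 θ) {S : Set Plane}
    (hS : S ⊆ cell) : ∀ᵐ y ∂volume.restrict S, ∀ i j,
      grad θ (u + v) i y j = grad θ u i y j + grad θ v i y j := by
  rw [ae_all_iff]; intro i
  rw [ae_all_iff]; intro j
  filter_upwards [ae_mono (Measure.restrict_mono hS le_rfl)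
    (coord_add (partialD θ j u) (partialD θ j v) i)] with y hy
  simp only [grad, partialD_add hu hv, hy]

lemma grad_smul {θ : Plane} {u : L2} (a : ℂ) (hu : u ∈ H1 θ) {S : Set Plane}
    (hS : S ⊆ cell) : ∀ᵐ y ∂volume.restrict S, ∀ i j,
      grad θ (a • u) i y j = a * grad θ u i y j := by
  rw [ae_all_iff]; intro i
  rw [ae_all_iff]; intro j
  filter_upwards [ae_mono (Measure.restrict_mono hS le_rfl)
    (coord_smul a (partialD θ j u) i)] with y hy
  simp only [grad, partialD_smul a hu, hy]

lemma b_add (P : Fibre) {θ : Plane} {u v : L2} (hu : u ∈ H1 θ) (hv : v ∈ H1 θ) (φ : L2) :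
    P.b θ (u + v) φ = P.b θ u φ + P.b θ v φ := by
  have h1 : ∀ᵐ y ∂volume.restrict (cell \ P.R), _ := grad_add hu hv sdiff_subset
  have h2 : ∀ᵐ y ∂volume.restrict P.R, _ := grad_add hu hv P.R_subset
  unfold b
  rw [integral_congr_ae (μ := volume.restrict (cell \ P.R)) (g := fun y =>
      (cdot (perp (grad θ u 0 y)) (grad θ φ 1 y) + cdot (grad θ u 1 y) (perp (grad θ φ 0 y))) +
      (cdot (perp (grad θ v 0 y)) (grad θ φ 1 y) + cdot (grad θ v 1 y) (perp (grad θ φ 0 y)))),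
    integral_add (integrable_cross θ u φ sdiff_subset) (integrable_cross θ v φ sdiff_subset),
    integral_congr_ae (μ := volume.restrict P.R) (g := fun y =>
      (cdot (grad θ u 0 y) (grad θ φ 0 y) + P.ε₀ * cdot (grad θ u 1 y) (grad θ φ 1 y) +
        cdot (perp (grad θ u 0 y)) (grad θ φ 1 y) + cdot (grad θ u 1 y) (perp (grad θ φ 0 y))) +
      (cdot (grad θ v 0 y) (grad θ φ 0 y) + P.ε₀ * cdot (grad θ v 1 y) (grad θ φ 1 y) +
        cdot (perp (grad θ v 0 y)) (grad θ φ 1 y) + cdot (grad θ v 1 y) (perp (grad θ φ 0 y)))),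
    integral_add (P.integrable_inner θ u φ) (P.integrable_inner θ v φ)]
  · ring
  · filter_upwards [h2] with y hy
    simp [cdot, perp, Fin.sum_univ_two, hy]
    ring
  · filter_upwards [h1] with y hy
    simp [cdot, perp, Fin.sum_univ_two, hy]
    ring

lemma b_smul (P : Fibre) {θ : Plane} {u : L2} (a : ℂ) (hu : u ∈ H1 θ) (φ : L2) :
    P.b θ (a • u) φ = a * P.b θ u φ := by
  have h1 : ∀ᵐ y ∂volume.restrict (cell \ P.R), _ := grad_smul a hu sdiff_subset
  have h2 : ∀ᵐ y ∂volume.restrict P.R, _ := grad_smul a hu P.R_subset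
  unfold b
  rw [integral_congr_ae (μ := volume.restrict (cell \ P.R)) (g := fun y => a *
      (cdot (perp (grad θ u 0 y)) (grad θ φ 1 y) + cdot (grad θ u 1 y) (perp (grad θ φ 0 y)))),
    integral_const_mul,
    integral_congr_ae (μ := volume.restrict P.R) (g := fun y => a *
      (cdot (grad θ u 0 y) (grad θ φ 0 y) + P.ε₀ * cdot (grad θ u 1 y) (grad θ φ 1 y) +
        cdot (perp (grad θ u 0 y)) (grad θ φ 1 y) + cdot (grad θ u 1 y) (perp (grad θ φ 0 y)))),
    integral_const_mul]
  · ring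
  · filter_upwards [h2] with y hy
    simp [cdot, perp, Fin.sum_univ_two, hy]
    ring
  · filter_upwards [h1] with y hy
    simp [cdot, perp, Fin.sum_univ_two, hy]
    ring

/-- `u + γ χ_R (0, u₂)`, the field representing the form `c` in `L²(□; ℂ²)`. -/
def weightFun (P : Fibre) (u : L2) (y : Plane) : EuclideanSpace ℂ (Fin 2) :=
  u y + P.R.indicator (fun y => (P.γ : ℂ) • EuclideanSpace.single (1 : Fin 2) (u y 1)) y

lemma memLp_weightFun (P : Fibre) (u : L2) :
    MemLp (P.weightFun u) 2 (volume.restrict cell) := by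
  refine (Lp.memLp u).add (MemLp.indicator P.isOpen.measurableSet ?_)
  have h := ((LinearMap.toContinuousLinearMap
    (LinearMap.toSpanSingleton ℂ (EuclideanSpace ℂ (Fin 2)) (EuclideanSpace.single 1 1))).comp_memLp'
      (memLp_coord u 1)).const_smul (P.γ : ℂ)
  refine h.ae_eq (Filter.Eventually.of_forall fun y => ?_)
  ext i
  fin_cases i <;> simp

lemma c_eq_inner (P : Fibre) (u φ : L2) :
    P.c u φ = inner ℂ φ ((P.memLp_weightFun u).toLp (P.weightFun u)) := by
  rw [L2.inner_def]
  have hR : ∫ y in P.R, u y 1 * conj (φ y 1) =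
      ∫ y in cell, P.R.indicator (fun y => u y 1 * conj (φ y 1)) y := by
    rw [setIntegral_indicator P.isOpen.measurableSet, inter_eq_right.2 P.R_subset]
  have hi0 : Integrable (fun y => cdot (u y) (φ y)) (volume.restrict cell) := by
    simp only [cdot, Fin.sum_univ_two]
    exact (integrable_mul_conj (memLp_coord u 0) (memLp_coord φ 0)).add
      (integrable_mul_conj (memLp_coord u 1) (memLp_coord φ 1))
  have hi1 : Integrable (P.R.indicator fun y => u y 1 * conj (φ y 1)) (volume.restrict cell) :=
    (integrable_mul_conj (memLp_coord u 1) (memLp_coord φ 1)).indicator P.isOpen.measurableSet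
  unfold c
  rw [hR, ← integral_const_mul, ← integral_add hi0 (hi1.const_mul _)]
  refine integral_congr_ae ?_
  filter_upwards [(P.memLp_weightFun u).coeFn_toLp] with y hy
  rw [hy]
  by_cases h : y ∈ P.R <;>
    simp [weightFun, h, cdot, PiLp.inner_apply, Fin.sum_univ_two]
  all_goals ring

lemma c_add (P : Fibre) (u v φ : L2) : P.c (u + v) φ = P.c u φ + P.c v φ := by
  simp only [c_eq_inner]
  rw [← inner_add_right]
  congr 1
  rw [← MemLp.toLp_add]
  refine (MemLp.toLp_eq_toLp_iff _ _).2 ?_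
  filter_upwards [Lp.coeFn_add u v] with y hy
  replace hy : (u + v : L2) y = u y + v y := hy
  simp only [weightFun, Pi.add_apply]
  by_cases h : y ∈ P.R
  · simp only [indicator_of_mem h, hy]
    ext i
    fin_cases i
    · simp
    · simp; ring
  · simp only [indicator_of_notMem h, hy, add_zero]

lemma c_smul (P : Fibre) (a : ℂ) (u φ : L2) : P.c (a • u) φ = a * P.c u φ := by
  simp only [c_eq_inner]
  rw [← inner_smul_right]
  congr 1
  rw [← MemLp.toLp_const_smul]
  refine (MemLp.toLp_eq_toLp_iff _ _).2 ?_
  filter_upwards [Lp.coeFn_smul a u] with y hy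
  replace hy : (a • u : L2) y = a • u y := hy
  simp only [weightFun, Pi.smul_apply]
  by_cases h : y ∈ P.R
  · simp only [indicator_of_mem h, hy]
    ext i
    fin_cases i
    · simp
    · simp; ring
  · simp only [indicator_of_notMem h, hy, add_zero]

lemma eq_zero_of_c_self (P : Fibre) {u : L2} (h : P.c u u = 0) : u = 0 := by
  have hγ : 0 < P.γ := sub_pos.2 P.one_lt
  have h1 : (∫ y in cell, cdot (u y) (u y)) = ((‖u‖ ^ 2 : ℝ) : ℂ) := by
    have := inner_self_eq_norm_sq_to_K (𝕜 := ℂ) u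
    rw [L2.inner_def] at this
    push_cast
    refine Eq.trans ?_ this
    refine integral_congr_ae (Filter.Eventually.of_forall fun y => ?_)
    simp only [cdot, PiLp.inner_apply, RCLike.inner_apply]
  have h2 : (∫ y in P.R, u y 1 * conj (u y 1)) = ((∫ y in P.R, ‖u y 1‖ ^ 2 : ℝ) : ℂ) := by
    rw [← integral_complex_ofReal]
    refine integral_congr_ae (Filter.Eventually.of_forall fun y => ?_)
    simp [Complex.mul_conj, Complex.normSq_eq_norm_sq]
  unfold c at h
  rw [h1, h2] at h
  have h3 : ‖u‖ ^ 2 + P.γ * (∫ y in P.R, ‖u y 1‖ ^ 2) = 0 := by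
    rw [← Complex.ofReal_mul, ← Complex.ofReal_add] at h
    exact Complex.ofReal_eq_zero.1 h
  have h4 : 0 ≤ ∫ y in P.R, ‖u y 1‖ ^ 2 := integral_nonneg fun y => by positivity
  have h5 : ‖u‖ ^ 2 = 0 := by nlinarith [sq_nonneg ‖u‖, mul_nonneg hγ.le h4]
  simpa using h5

/-- The Hilbert space `ℋ`: the closure of `V(θ)` in `L²(□; ℂ²)` (with the inner product `c`). -/
def Hsp (P : Fibre) (θ : Plane) : Submodule ℂ L2 := (P.V θ).topologicalClosure

/-- The graph of `𝓑(θ)`: the pairs `(v, h)` with `v ∈ V(θ)`, `h ∈ ℋ` and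
`b(v, φ) = c(h, φ)` for all `φ ∈ V(θ)`. -/
def graphB (P : Fibre) (θ : Plane) : Submodule ℂ (P.Hsp θ × P.Hsp θ) where
  carrier := {p | (p.1 : L2) ∈ P.V θ ∧ ∀ φ ∈ P.V θ, P.b θ p.1 φ = P.c p.2 φ}
  add_mem' := by
    rintro p q ⟨hp, hp'⟩ ⟨hq, hq'⟩
    refine ⟨add_mem hp hq, fun φ hφ => ?_⟩
    change P.b θ ((p.1 : L2) + q.1) φ = P.c ((p.2 : L2) + q.2) φ
    rw [P.b_add hp.1 hq.1, P.c_add, hp' φ hφ, hq' φ hφ]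
  zero_mem' := by
    refine ⟨zero_mem _, fun φ _ => ?_⟩
    change P.b θ (0 : L2) φ = P.c (0 : L2) φ
    have hb := P.b_smul 0 (zero_mem (H1 θ)) φ
    have hc := P.c_smul 0 0 φ
    rw [zero_smul, zero_mul] at hb hc
    rw [hb, hc]
  smul_mem' := by
    rintro a p ⟨hp, hp'⟩
    refine ⟨Submodule.smul_mem _ a hp, fun φ hφ => ?_⟩
    change P.b θ (a • (p.1 : L2)) φ = P.c (a • (p.2 : L2)) φ
    rw [P.b_smul a hp.1, P.c_smul, hp' φ hφ]

/-- The graph is single-valued, since `V(θ)` is dense in `ℋ`. -/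
lemma graphB_single_valued (P : Fibre) (θ : Plane) :
    ∀ p ∈ P.graphB θ, p.1 = 0 → p.2 = 0 := by
  rintro ⟨v, h⟩ ⟨_, hp⟩ hv
  obtain rfl : v = 0 := hv
  have hb : ∀ φ, P.b θ ((0 : P.Hsp θ) : L2) φ = 0 := fun φ => by
    have hb := P.b_smul 0 (zero_mem (H1 θ)) φ
    rwa [zero_smul, zero_mul] at hb
  have hc : ∀ φ ∈ P.V θ, P.c (h : L2) φ = 0 := fun φ hφ => by rw [← hp φ hφ]; exact hb φ
  have hcl : IsClosed {φ : L2 | P.c (h : L2) φ = 0} := by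
    simp only [c_eq_inner]
    exact isClosed_eq (by fun_prop) continuous_const
  have hmem : (h : L2) ∈ {φ : L2 | P.c (h : L2) φ = 0} :=
    closure_minimal (s := (P.V θ : Set L2)) (fun φ hφ => hc φ hφ) hcl h.2
  exact Subtype.ext (P.eq_zero_of_c_self hmem)

/-- The operator `𝓑(θ)` in `ℋ` generated by the form `b` with form domain `V(θ)`:
`b(v, φ) = c(𝓑(θ) v, φ)` for `v ∈ dom 𝓑(θ)` and `φ ∈ V(θ)`. -/
def B (P : Fibre) (θ : Plane) : P.Hsp θ →ₗ.[ℂ] P.Hsp θ := (P.graphB θ).toLinearPMap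

lemma graph_B (P : Fibre) (θ : Plane) : (P.B θ).graph = P.graphB θ :=
  Submodule.toLinearPMap_graph_eq _ (P.graphB_single_valued θ)

end Fibre

/-- `(μ, x)` is an eigenvalue-eigenvector pair of the (unbounded) operator `T`. -/
def IsEigenpair {X : Type*} [AddCommGroup X] [Module ℂ X] (T : X →ₗ.[ℂ] X) (μ : ℂ) (x : X) : Prop :=
  x ≠ 0 ∧ ∃ hx : x ∈ T.domain, T ⟨x, hx⟩ = μ • x

/-! ### The Maxwell system -/

/-- Space-time, with coordinates `((x₁, x₂), (x₃, t))`. -/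
abbrev SpaceTime : Type := Plane × (ℝ × ℝ)

/-- The spatial coordinate directions. -/
def spaceDir : Fin 3 → SpaceTime := ![((1, 0), (0, 0)), ((0, 1), (0, 0)), ((0, 0), (1, 0))]

/-- The time direction. -/
def timeDir : SpaceTime := ((0, 0), (0, 1))

/-- The distributional derivative of `f` in direction `e`, evaluated at the test function `ψ`. -/
def distDeriv (e : SpaceTime) (f ψ : SpaceTime → ℂ) : ℂ := -∫ p, f p * fderiv ℝ ψ p e

/-- The `i`-th component `∂_{i+1} F_{i+2} - ∂_{i+2} F_{i+1}` (indices modulo 3) of the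
distributional curl of `F`, evaluated at the test function `ψ`. -/
def distCurl (F : SpaceTime → Fin 3 → ℂ) (i : Fin 3) (ψ : SpaceTime → ℂ) : ℂ :=
  distDeriv (spaceDir (i + 1)) (fun p => F p (i + 2)) ψ -
    distDeriv (spaceDir (i + 2)) (fun p => F p (i + 1)) ψ

/-- The permittivity: `ε₀` in the `2π`-periodic translates of `R` and `1` elsewhere. -/
def Fibre.permittivity (P : Fibre) (y : Plane) : ℝ :=
  open Classical in
  if ∃ z : ℤ × ℤ, y - (2 * Real.pi * z.1, 2 * Real.pi * z.2) ∈ P.R then P.ε₀ else 1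

/-- `(E, H)` is a solution, in the sense of distributions on space-time, of the Maxwell system
`∇ × H = -ε ∂E/∂t`, `∇ × E = ∂H/∂t`. As `ε` does not depend on time, `ε ∂E/∂t = ∂(εE)/∂t`. -/
def Fibre.IsMaxwellSolution (P : Fibre) (E H : SpaceTime → Fin 3 → ℂ) : Prop :=
  LocallyIntegrable E ∧ LocallyIntegrable H ∧
  ∀ ψ : SpaceTime → ℂ, ContDiff ℝ (⊤ : ℕ∞) ψ → HasCompactSupport ψ → ∀ i : Fin 3,
    distCurl H i ψ = -distDeriv timeDir (fun p => P.permittivity p.1 * E p i) ψ ∧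
    distCurl E i ψ = distDeriv timeDir (fun p => H p i) ψ

/-- The wave `exp (i ω (k x₃ - t)) A(x₁, x₂)` with amplitude `A`. -/
def planeWave (ω k : ℝ) (A : Plane → Fin 3 → ℂ) (p : SpaceTime) : Fin 3 → ℂ :=
  Complex.exp (Complex.I * ω * (k * p.2.1 - p.2.2)) • A p.1

/-- `A ∈ L²_loc(ℝ²; ℂ³)`. -/
def IsLocallyL2 (A : Plane → Fin 3 → ℂ) : Prop :=
  ∀ K : Set Plane, IsCompact K → MemLp A 2 (volume.restrict K)

end PCF

end

/-!
Writing `v = (v₁, v₂) = (H₃, E₃)` and `w = (v₁, ε v₂)`, the Maxwell system for waves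
`exp (i ω (x₃ - t))` with wave number `ω` reduces, for `ω ≠ 0`, to finding a quasi-periodic field
`q ∈ H¹_θ` with `(curl q, div q) = -i ω w`: the transverse amplitudes are then
`(E₁, E₂) = ∇ v₂ / (i ω) + q` and `(H₁, H₂) = (q₂, -q₁)`. All equations except the transverse part
of `∇ × H = i ω ε E` follow at once. The latter is the pointwise relation
`i ω (ε - 1) (E₁, E₂) = -(curl v, div v)`: outside the inclusion `R` it is the constraint in the
definition of `V(θ)`, and inside `R` it has to be derived from the eigenvalue equation.

The operator `S φ = (curl φ, div φ)` acts on Fourier coefficients at the frequency `ξ = k + θ` by a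
matrix with determinant of modulus `|ξ|²`. It is therefore onto `L²(□; ℂ²)`, except that for
`θ = 0` its range consists of the fields of mean zero (`exists_curl_div_eq`). This provides `q`; for
`θ = 0` the field `w` has mean zero because constants belong to `V(0)`
(`Fibre.integral_eq_zero_of_eigen`), and `q` is determined up to a constant. On `V(θ)` the form is
`b(v, φ) = ∫_□ ∇ v₂ · ∇ φ̄₂ + γ⁻¹ ∫_R S v · conj (S φ)` (`Fibre.b_eq`). Hence the eigenvalue
equation says that the defect `i ω γ (E₁, E₂) + S v` on `R` is orthogonal to `S φ` for all
`φ ∈ V(θ)`. As `S` is onto, one may choose `φ ∈ V(θ)` such that `S φ` equals this defect on `R` and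
vanishes elsewhere, after fixing the constant in `q` so that the defect has mean zero if `θ = 0`.
So the defect vanishes (`Fibre.ae_eq_zero_of_eigen`).

For `ω = 0` the same formula for `b` gives `∇ v = 0`, and the transverse fields can be taken to be
zero.

Finally, a distributional equation on space-time is reduced to the cell. By Fubini's theorem it
suffices to test at fixed `(x₃, t)` with functions of `(x₁, x₂)`, after integrating by parts in
`x₃` and `t`; and pairing a quasi-periodic amplitude with such a function over the plane is pairing
it over the cell with the quasi-periodisation (`integral_mul_eq_ip_periodize`).
-/

noncomputable section

namespace PCF

/-! ### Quasi-periodic functions and lattice translations -/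

/-- The lattice vector `2π z`. -/
def latticeVec (z : ℤ × ℤ) : Plane := (2 * Real.pi * z.1, 2 * Real.pi * z.2)

/-- The factor `exp (2π i θ · z)` picked up by a `θ`-quasi-periodic function under translation by
`2π z`. -/
def phase (θ : Plane) (z : ℤ × ℤ) : ℂ :=
  Complex.exp (2 * Real.pi * Complex.I * (θ.1 * z.1 + θ.2 * z.2))

lemma latticeVec_add (z w : ℤ × ℤ) : latticeVec (z + w) = latticeVec z + latticeVec w := by
  ext <;> simp [latticeVec, mul_add]

lemma phase_add (θ : Plane) (z w : ℤ × ℤ) : phase θ (z + w) = phase θ z * phase θ w := by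
  simp only [phase, ← Complex.exp_add]
  congr 1
  push_cast [Prod.fst_add, Prod.snd_add]
  ring

lemma phase_ne_zero (θ : Plane) (z : ℤ × ℤ) : phase θ z ≠ 0 := Complex.exp_ne_zero _

lemma conj_phase (θ : Plane) (z : ℤ × ℤ) :
    conj (phase θ z) = Complex.exp (-(2 * Real.pi * Complex.I * (θ.1 * z.1 + θ.2 * z.2))) := by
  rw [phase, ← Complex.exp_conj]
  congr 1
  simp [map_ofNat]

lemma QuasiPeriodic.add_latticeVec {F : Type*} [AddCommGroup F] [Module ℂ F] {θ : Plane}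
    {f : Plane → F} (hf : QuasiPeriodic θ f) (z : ℤ × ℤ) (y : Plane) :
    f (y + latticeVec z) = phase θ z • f y := by
  have h1 : ∀ (m : ℤ) (y : Plane), f (y + latticeVec (m, 0)) = phase θ (m, 0) • f y := by
    intro m
    have e : ∀ k : ℤ, ((k + 1, 0) : ℤ × ℤ) = (k, 0) + (1, 0) := fun k => by simp
    have step : ∀ y : Plane, f (y + latticeVec (1, 0)) = phase θ (1, 0) • f y := by
      intro y
      simpa [latticeVec, phase] using (hf y).1
    induction m using Int.induction_on with
    | zero => intro y; simp [latticeVec, phase, ← Prod.zero_eq_mk]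
    | succ k ih =>
      intro y
      rw [e, latticeVec_add, phase_add, ← add_assoc, step, ih, smul_smul, mul_comm]
    | pred k ih =>
      intro y
      have e' : ((-(k : ℤ), 0) : ℤ × ℤ) = (-(k : ℤ) - 1, 0) + (1, 0) := by simp
      have h := ih y
      rw [e', latticeVec_add, phase_add, ← add_assoc, step, mul_comm, ← smul_smul] at h
      exact smul_right_injective F (phase_ne_zero θ (1, 0)) h
  have h2 : ∀ (m : ℤ) (y : Plane), f (y + latticeVec (0, m)) = phase θ (0, m) • f y := by
    intro m
    have e : ∀ k : ℤ, ((0, k + 1) : ℤ × ℤ) = (0, k) + (0, 1) := fun k => by simp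
    have step : ∀ y : Plane, f (y + latticeVec (0, 1)) = phase θ (0, 1) • f y := by
      intro y
      simpa [latticeVec, phase] using (hf y).2
    induction m using Int.induction_on with
    | zero => intro y; simp [latticeVec, phase, ← Prod.zero_eq_mk]
    | succ k ih =>
      intro y
      rw [e, latticeVec_add, phase_add, ← add_assoc, step, ih, smul_smul, mul_comm]
    | pred k ih =>
      intro y
      have e' : ((0, -(k : ℤ)) : ℤ × ℤ) = (0, -(k : ℤ) - 1) + (0, 1) := by simp
      have h := ih y
      rw [e', latticeVec_add, phase_add, ← add_assoc, step, mul_comm, ← smul_smul] at h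
      exact smul_right_injective F (phase_ne_zero θ (0, 1)) h
  have e : z = (z.1, 0) + (0, z.2) := by ext <;> simp
  rw [e, latticeVec_add, phase_add, ← add_assoc, h2, h1, smul_smul, mul_comm]

/-! ### Fourier series of quasi-periodic functions -/

/-- Square-integrable complex-valued functions on the cell. -/
def SqInt (f : Plane → ℂ) : Prop := MemLp f 2 (volume.restrict cell)

/-- The `j`-th component of the frequency `ξ = k + θ`. -/
def freq (θ : Plane) (k : ℤ × ℤ) : Fin 2 → ℝ := ![θ.1 + k.1, θ.2 + k.2]

/-- The normalised exponential `(2π)⁻¹ exp (i ξ · y)` with `ξ = k + θ`. -/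
def char (θ : Plane) (k : ℤ × ℤ) (y : Plane) : ℂ :=
  (2 * Real.pi : ℂ)⁻¹ * Complex.exp (Complex.I * (freq θ k 0 * y.1 + freq θ k 1 * y.2))

/-- The Fourier coefficient of `f` at the frequency `k + θ`. -/
def coef (θ : Plane) (k : ℤ × ℤ) (f : Plane → ℂ) : ℂ := ∫ y in cell, f y * conj (char θ k y)

lemma contDiff_char (θ : Plane) (k : ℤ × ℤ) : ContDiff ℝ (⊤ : ℕ∞) (char θ k) := by
  have h : ContDiff ℝ (⊤ : ℕ∞) (fun x : ℝ => (x : ℂ)) := Complex.ofRealCLM.contDiff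
  have h1 : ContDiff ℝ (⊤ : ℕ∞) (fun y : Plane => (y.1 : ℂ)) := h.comp contDiff_fst
  have h2 : ContDiff ℝ (⊤ : ℕ∞) (fun y : Plane => (y.2 : ℂ)) := h.comp contDiff_snd
  unfold char
  exact contDiff_const.mul (contDiff_const.mul
    ((contDiff_const.mul h1).add (contDiff_const.mul h2))).cexp

lemma sqInt_char (θ : Plane) (k : ℤ × ℤ) : SqInt (char θ k) :=
  memLp_of_continuous (contDiff_char θ k).continuous

lemma quasiPeriodic_char (θ : Plane) (k : ℤ × ℤ) : QuasiPeriodic θ (char θ k) := by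
  intro y
  constructor
  · simp only [char, smul_eq_mul, Prod.fst_add, Prod.snd_add, freq]
    rw [mul_left_comm, ← Complex.exp_add]
    congr 1
    rw [Complex.exp_eq_exp_iff_exists_int]
    exact ⟨k.1, by push_cast [Matrix.cons_val_zero, Matrix.cons_val_one]; ring⟩
  · simp only [char, smul_eq_mul, Prod.fst_add, Prod.snd_add, freq]
    rw [mul_left_comm, ← Complex.exp_add]
    congr 1
    rw [Complex.exp_eq_exp_iff_exists_int]
    exact ⟨k.2, by push_cast [Matrix.cons_val_zero, Matrix.cons_val_one]; ring⟩

lemma integral_exp_int (m : ℤ) :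
    ∫ x in Ico (-Real.pi) Real.pi, Complex.exp (Complex.I * m * x) =
      if m = 0 then (2 * Real.pi : ℂ) else 0 := by
  have hpi := Real.pi_pos
  rw [integral_Ico_eq_integral_Ioc, ← intervalIntegral.integral_of_le (by linarith)]
  split_ifs with h
  · subst h
    simp
    norm_cast
    ring_nf
  · have hm : Complex.I * m ≠ 0 := mul_ne_zero Complex.I_ne_zero (by exact_mod_cast h)
    rw [integral_exp_mul_complex hm, div_eq_zero_iff]
    left
    rw [sub_eq_zero, Complex.exp_eq_exp_iff_exists_int]
    exact ⟨m, by push_cast; ring⟩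

lemma integral_char_mul_conj (θ : Plane) (k l : ℤ × ℤ) :
    ∫ y in cell, char θ k y * conj (char θ l y) = if k = l then 1 else 0 := by
  have hpi : (Real.pi : ℂ) ≠ 0 := by exact_mod_cast Real.pi_pos.ne'
  have h : ∀ y : Plane, char θ k y * conj (char θ l y) =
      ((2 * Real.pi : ℂ)⁻¹ * Complex.exp (Complex.I * (k.1 - l.1 : ℤ) * y.1)) *
        ((2 * Real.pi : ℂ)⁻¹ * Complex.exp (Complex.I * (k.2 - l.2 : ℤ) * y.2)) := by
    intro y
    simp only [char, freq, map_mul, ← Complex.exp_conj]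
    rw [mul_mul_mul_comm, mul_mul_mul_comm ((2 * Real.pi : ℂ)⁻¹) (Complex.exp _), ← Complex.exp_add,
      ← Complex.exp_add]
    congr 1
    · simp [map_ofNat]
    · congr 1
      simp
      ring
  simp_rw [h, cell]
  rw [Measure.volume_eq_prod, setIntegral_prod_mul (fun x : ℝ => (2 * Real.pi : ℂ)⁻¹ *
    Complex.exp (Complex.I * (k.1 - l.1 : ℤ) * x)) (fun x : ℝ => (2 * Real.pi : ℂ)⁻¹ *
    Complex.exp (Complex.I * (k.2 - l.2 : ℤ) * x)), integral_const_mul, integral_const_mul,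
    integral_exp_int, integral_exp_int]
  by_cases h1 : k.1 = l.1 <;> by_cases h2 : k.2 = l.2 <;>
    simp [h1, h2, Prod.ext_iff, sub_eq_zero]
  field_simp

lemma exists_field {f : Fin 2 → Plane → ℂ} (hf : ∀ i, SqInt (f i)) :
    ∃ u : L2, ∀ᵐ y ∂volume.restrict cell, ∀ i, u y i = f i y := by
  have h : MemLp (fun y => WithLp.toLp 2 fun i => f i y : Plane → EuclideanSpace ℂ (Fin 2)) 2
      (volume.restrict cell) := MemLp.of_eval_piLp fun i => hf i
  refine ⟨h.toLp _, ?_⟩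
  filter_upwards [h.coeFn_toLp] with y hy i
  rw [hy]

/-- The projection of the plane onto the torus `(ℝ/ℤ)²`. -/
def toTorus : C(Plane, UnitAddTorus (Fin 2)) where
  toFun y := Pi.map (fun _ (x : ℝ) => (x : AddCircle (1 : ℝ)))
    (Homeomorph.finTwoArrow.symm ((2 * Real.pi)⁻¹ • y))
  continuous_toFun := (Continuous.piMap fun _ => AddCircle.continuous_mk' 1).comp
    (Homeomorph.finTwoArrow.symm.continuous.comp (continuous_const_smul _))

lemma toTorus_apply_zero (y : Plane) :
    toTorus y 0 = (((2 * Real.pi)⁻¹ * y.1 : ℝ) : AddCircle (1 : ℝ)) := rfl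

lemma toTorus_apply_one (y : Plane) :
    toTorus y 1 = (((2 * Real.pi)⁻¹ * y.2 : ℝ) : AddCircle (1 : ℝ)) := rfl

lemma isQuotientMap_toTorus : Topology.IsQuotientMap toTorus := by
  have h1 : IsOpenQuotientMap (Pi.map (fun (_ : Fin 2) (x : ℝ) => (x : AddCircle (1 : ℝ)))) :=
    IsOpenQuotientMap.piMap fun _ => QuotientAddGroup.isOpenQuotientMap_mk
  have h2 : Topology.IsQuotientMap
      (Homeomorph.finTwoArrow.symm : ℝ × ℝ → (Fin 2 → ℝ)) := Homeomorph.isQuotientMap _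
  have h3 : Topology.IsQuotientMap (fun y : Plane => (2 * Real.pi)⁻¹ • y) :=
    (Homeomorph.smulOfNeZero ((2 * Real.pi)⁻¹) (inv_ne_zero (by positivity))).isQuotientMap
  exact (h1.isQuotientMap.comp h2).comp h3

lemma exists_latticeVec_of_toTorus_eq {x y : Plane} (h : toTorus x = toTorus y) :
    ∃ z, x = y + latticeVec z := by
  have hpi : (2 * Real.pi) ≠ 0 := by positivity
  have key : ∀ a b : ℝ, (((2 * Real.pi)⁻¹ * a : ℝ) : AddCircle (1 : ℝ)) =
      (((2 * Real.pi)⁻¹ * b : ℝ) : AddCircle (1 : ℝ)) → ∃ m : ℤ, a = b + 2 * Real.pi * m := by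
    intro a b hab
    obtain ⟨m, hm⟩ := AddSubgroup.mem_zmultiples_iff.1 (QuotientAddGroup.eq.1 hab.symm)
    refine ⟨m, ?_⟩
    simp only [zsmul_eq_mul, mul_one] at hm
    rw [hm]
    field_simp
    ring
  obtain ⟨m, hm⟩ := key x.1 y.1 (congrFun h 0)
  obtain ⟨n, hn⟩ := key x.2 y.2 (congrFun h 1)
  exact ⟨(m, n), Prod.ext hm hn⟩

lemma mFourier_toTorus (n : Fin 2 → ℤ) (y : Plane) :
    UnitAddTorus.mFourier n (toTorus y) = Complex.exp (Complex.I * (n 0 * y.1 + n 1 * y.2)) := by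
  have hpi : (Real.pi : ℂ) ≠ 0 := by exact_mod_cast Real.pi_pos.ne'
  simp only [UnitAddTorus.mFourier, ContinuousMap.coe_mk, Fin.prod_univ_two,
    toTorus_apply_zero, toTorus_apply_one, fourier_coe_apply, ← Complex.exp_add]
  congr 1
  push_cast
  field_simp

lemma integrable_mul_char_mul_torus (θ : Plane) {f : Plane → ℂ} (hf : SqInt f)
    (p : C(UnitAddTorus (Fin 2), ℂ)) :
    Integrable (fun y => f y * (char θ 0 y * p (toTorus y))) (volume.restrict cell) := by
  have hc : Continuous fun y => conj (char θ 0 y * p (toTorus y)) :=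
    Complex.continuous_conj.comp ((contDiff_char θ 0).continuous.mul
      (p.continuous.comp toTorus.continuous))
  simpa using integrable_mul_conj hf (memLp_of_continuous hc)

/-- Completeness of the exponentials. By the uniform density of trigonometric polynomials in the
continuous functions on the torus, `f` is orthogonal to all continuous quasi-periodic functions. -/
lemma ae_eq_zero_of_coef {θ : Plane} {f : Plane → ℂ} (hf : SqInt f)
    (h : ∀ k, coef θ k f = 0) : ∀ᵐ y ∂volume.restrict cell, f y = 0 := by
  have hfs : SqInt (fun y => conj (f y)) := hf.star
  -- the functional `p ↦ ∫ f̄ exp (i θ · y) p` on the continuous functions on the torus;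
  -- it is shown to vanish
  let ℓ₀ : C(UnitAddTorus (Fin 2), ℂ) →ₗ[ℂ] ℂ :=
    { toFun := fun p => ∫ y in cell, conj (f y) * (char θ 0 y * p (toTorus y))
      map_add' := fun p q => by
        rw [← integral_add (integrable_mul_char_mul_torus θ hfs p)
          (integrable_mul_char_mul_torus θ hfs q)]
        simp only [ContinuousMap.add_apply, mul_add]
      map_smul' := fun a p => by
        simp only [ContinuousMap.smul_apply, smul_eq_mul, RingHom.id_apply]
        rw [← integral_const_mul]
        congr 1
        ext y
        ring }
  let ℓ : C(UnitAddTorus (Fin 2), ℂ) →L[ℂ] ℂ :=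
    ℓ₀.mkContinuous (∫ y in cell, ‖conj (f y) * char θ 0 y‖) (fun p => by
      refine (norm_integral_le_integral_norm _).trans ?_
      rw [← integral_mul_const]
      refine integral_mono_of_nonneg (Filter.Eventually.of_forall fun y => norm_nonneg _) ?_ ?_
      · have := integrable_mul_char_mul_torus θ hfs 1
        simp only [ContinuousMap.one_apply, mul_one] at this
        exact this.norm.mul_const _
      · refine Filter.Eventually.of_forall fun y => ?_
        simp only [← mul_assoc]
        rw [norm_mul]
        exact mul_le_mul_of_nonneg_left (p.norm_coe_le_norm _) (norm_nonneg _))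
  have hℓ : ∀ p, ℓ p = 0 := by
    have hspan : Submodule.span ℂ (range (UnitAddTorus.mFourier (d := Fin 2))) ≤ ℓ.ker := by
      rw [Submodule.span_le]
      rintro _ ⟨n, rfl⟩
      change ∫ y in cell, conj (f y) * (char θ 0 y * UnitAddTorus.mFourier n (toTorus y)) = 0
      have h1 := congrArg conj (h (n 0, n 1))
      rw [coef, ← integral_conj, map_zero] at h1
      rw [← h1]
      congr 1
      ext y
      rw [map_mul, Complex.conj_conj, mFourier_toTorus, char, char, mul_assoc, ← Complex.exp_add]
      congr 3
      simp [freq]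
      ring
    have hcl : (Submodule.span ℂ (range (UnitAddTorus.mFourier (d := Fin 2)))).topologicalClosure
        ≤ ℓ.ker := Submodule.topologicalClosure_minimal _ hspan ℓ.isClosed_ker
    rw [UnitAddTorus.span_mFourier_closure_eq_top] at hcl
    exact fun p => hcl Submodule.mem_top
  have hz : SqInt fun _ => 0 := memLp_of_continuous continuous_const
  obtain ⟨u, hu⟩ := exists_field (f := ![f, fun _ => 0])
    (fun i => by fin_cases i; exacts [hf, hz])
  have hu0 : u = 0 := by
    refine eq_zero_of_pair (θ := θ) fun φ hφ hq i => ?_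
    fin_cases i
    · -- the periodic function `exp (-i θ · y) φ` descends to the torus
      have hpi : (2 * Real.pi : ℂ) ≠ 0 := by exact_mod_cast Real.two_pi_pos.ne'
      have hchar : ∀ y, char θ 0 y ≠ 0 := fun y =>
        mul_ne_zero (inv_ne_zero hpi) (Complex.exp_ne_zero _)
      let g : C(ℝ × ℝ, ℂ) := ⟨fun y => φ y / char θ 0 y,
        hφ.continuous.div (contDiff_char θ 0).continuous hchar⟩
      have hg : Function.FactorsThrough g toTorus := by
        intro x y hxy
        obtain ⟨z, rfl⟩ := exists_latticeVec_of_toTorus_eq hxy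
        change φ _ / char θ 0 _ = φ y / char θ 0 y
        rw [hq.add_latticeVec, (quasiPeriodic_char θ 0).add_latticeVec, smul_eq_mul, smul_eq_mul,
          mul_div_mul_left _ _ (phase_ne_zero θ z)]
      let p : C(UnitAddTorus (Fin 2), ℂ) := isQuotientMap_toTorus.lift g hg
      have hp : ∀ y, char θ 0 y * p (toTorus y) = φ y := by
        intro y
        have : p (toTorus y) = g y :=
          DFunLike.congr_fun (isQuotientMap_toTorus.lift_comp g hg) y
        rw [this]
        exact mul_div_cancel₀ _ (hchar y)
      have h2 := congrArg conj (hℓ p)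
      change conj (∫ y in cell, conj (f y) * (char θ 0 y * p (toTorus y))) = conj 0 at h2
      rw [← integral_conj, map_zero] at h2
      rw [← h2]
      refine integral_congr_ae ?_
      filter_upwards [hu] with y hy
      rw [hp, map_mul, Complex.conj_conj]
      exact congrArg (· * conj (φ y)) (hy 0)
    · have : ∫ y in cell, (0 : ℂ) = 0 := by simp
      rw [← this]
      refine integral_congr_ae ?_
      filter_upwards [hu] with y hy
      have h1 := hy 1
      simp only [Matrix.cons_val_one, Matrix.cons_val_fin_one] at h1
      simp [h1]
  subst hu0
  filter_upwards [hu, coord_zero 0] with y hy h0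
  exact (hy 0).symm.trans h0

lemma SqInt.congr {f g : Plane → ℂ} (hf : SqInt f)
    (h : ∀ᵐ y ∂volume.restrict cell, f y = g y) : SqInt g := (memLp_congr_ae h).1 hf

lemma coef_congr {f g : Plane → ℂ} (θ : Plane) (k : ℤ × ℤ)
    (h : ∀ᵐ y ∂volume.restrict cell, f y = g y) : coef θ k f = coef θ k g := by
  refine integral_congr_ae ?_
  filter_upwards [h] with y hy
  rw [hy]

lemma coef_add {f g : Plane → ℂ} (θ : Plane) (k : ℤ × ℤ) (hf : SqInt f) (hg : SqInt g) :
    coef θ k (fun y => f y + g y) = coef θ k f + coef θ k g := by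
  simp only [coef, add_mul]
  exact integral_add (integrable_mul_conj hf (sqInt_char θ k))
    (integrable_mul_conj hg (sqInt_char θ k))

lemma coef_const_mul (θ : Plane) (k : ℤ × ℤ) (a : ℂ) (f : Plane → ℂ) :
    coef θ k (fun y => a * f y) = a * coef θ k f := by
  simp only [coef, mul_assoc]
  exact integral_const_mul _ _

lemma ae_eq_of_coef {θ : Plane} {f g : Plane → ℂ} (hf : SqInt f) (hg : SqInt g)
    (h : ∀ k, coef θ k f = coef θ k g) : ∀ᵐ y ∂volume.restrict cell, f y = g y := by
  have hg' : SqInt fun y => (-1) * g y := hg.const_mul (-1)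
  have := ae_eq_zero_of_coef (θ := θ) (f := fun y => f y + (-1) * g y) (hf.add hg') fun k => by
    rw [coef_add θ k hf hg', coef_const_mul, h]
    ring
  filter_upwards [this] with y hy
  linear_combination hy

/-- The normalised exponential as an element of `L²(□)`. -/
def charLp (θ : Plane) (k : ℤ × ℤ) : Lp ℂ 2 (volume.restrict cell) :=
  MemLp.toLp (char θ k) (sqInt_char θ k)

lemma inner_toLp {f g : Plane → ℂ} (hf : SqInt f) (hg : SqInt g) :
    inner ℂ (MemLp.toLp g hg) (MemLp.toLp f hf) = ∫ y in cell, f y * conj (g y) := by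
  rw [L2.inner_def]
  refine integral_congr_ae ?_
  filter_upwards [MemLp.coeFn_toLp hf, MemLp.coeFn_toLp hg] with y h1 h2
  rw [h1, h2, RCLike.inner_apply]

lemma orthonormal_charLp (θ : Plane) : Orthonormal ℂ (charLp θ) := by
  rw [orthonormal_iff_ite]
  intro k l
  rw [charLp, charLp, inner_toLp, integral_char_mul_conj]
  simp only [eq_comm]

/-- The exponentials with frequencies in `ℤ² + θ` as a Hilbert basis of `L²(□)`. -/
def fourierBasis (θ : Plane) : HilbertBasis (ℤ × ℤ) ℂ (Lp ℂ 2 (volume.restrict cell)) :=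
  HilbertBasis.mkOfOrthogonalEqBot (orthonormal_charLp θ) <| by
    rw [Submodule.eq_bot_iff]
    intro f hf
    have hf2 : SqInt f := Lp.memLp f
    have h0 := ae_eq_zero_of_coef (θ := θ) hf2 fun k => by
      have h := (Submodule.mem_orthogonal _ _).1 hf (charLp θ k)
        (Submodule.subset_span (mem_range_self k))
      rwa [charLp, ← Lp.toLp_coeFn f hf2, inner_toLp hf2 (sqInt_char θ k)] at h
    refine Lp.ext ?_
    filter_upwards [h0, Lp.coeFn_zero ℂ 2 (volume.restrict cell)] with y h1 h2
    rw [h1, h2]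
    rfl

lemma fourierBasis_apply (θ : Plane) (k : ℤ × ℤ) : fourierBasis θ k = charLp θ k := by
  rw [fourierBasis, HilbertBasis.coe_mkOfOrthogonalEqBot]

lemma fourierBasis_repr {f : Plane → ℂ} (θ : Plane) (k : ℤ × ℤ) (hf : SqInt f) :
    (fourierBasis θ).repr (MemLp.toLp f hf) k = coef θ k f := by
  rw [HilbertBasis.repr_apply_apply, fourierBasis_apply, charLp, inner_toLp]
  rfl

/-- Parseval's identity. -/
lemma hasSum_coef_mul_conj (θ : Plane) {f g : Plane → ℂ} (hf : SqInt f) (hg : SqInt g) :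
    HasSum (fun k => coef θ k f * conj (coef θ k g)) (∫ y in cell, f y * conj (g y)) := by
  have h := (fourierBasis θ).hasSum_inner_mul_inner (MemLp.toLp g hg) (MemLp.toLp f hf)
  rw [inner_toLp] at h
  refine h.congr_fun fun k => ?_
  rw [fourierBasis_apply, charLp, inner_toLp hf (sqInt_char θ k), ← inner_conj_symm,
    inner_toLp hg (sqInt_char θ k), mul_comm]
  rfl

/-- The Riesz–Fischer theorem, for coefficients dominated by those of two given functions. -/
lemma exists_sqInt_coef_eq (θ : Plane) {f g : Plane → ℂ} (hf : SqInt f) (hg : SqInt g)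
    {c : ℤ × ℤ → ℂ} {C : ℝ} (hc : ∀ k, ‖c k‖ ≤ C * (‖coef θ k f‖ + ‖coef θ k g‖)) :
    ∃ h, SqInt h ∧ ∀ k, coef θ k h = c k := by
  have hmem : ∀ {f : Plane → ℂ} (_ : SqInt f), Memℓp (fun k => coef θ k f) 2 := by
    intro f hf
    have h := lp.memℓp ((fourierBasis θ).repr (MemLp.toLp f hf))
    have e : (fun k => coef θ k f) = (fourierBasis θ).repr (MemLp.toLp f hf) := by
      ext k
      rw [fourierBasis_repr]
    rw [e]
    exact h
  have hcm : Memℓp c 2 := by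
    have h2 : ∀ {a : ℤ × ℤ → ℂ}, Memℓp a 2 ↔ Summable fun k => ‖a k‖ ^ 2 := by
      intro a
      rw [memℓp_gen_iff (by norm_num)]
      simp
    rw [h2]
    have h3 := ((h2.1 (hmem hf)).add (h2.1 (hmem hg))).mul_left (2 * C ^ 2)
    refine Summable.of_nonneg_of_le (fun k => by positivity) (fun k => ?_) h3
    have h4 := pow_le_pow_left₀ (norm_nonneg _) (hc k) 2
    have h5 := mul_nonneg (sq_nonneg C) (sq_nonneg (‖coef θ k f‖ - ‖coef θ k g‖))
    nlinarith
  let h := (fourierBasis θ).repr.symm ⟨c, hcm⟩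
  refine ⟨h, Lp.memLp h, fun k => ?_⟩
  rw [← fourierBasis_repr θ k (Lp.memLp h), Lp.toLp_coeFn]
  simp [h]

/-! ### Weak derivatives of quasi-periodic functions -/

/-- `g` is the weak `j`-th partial derivative of the `θ`-quasi-periodic function `f`, expressed
by means of Fourier coefficients. -/
def IsPartial (θ : Plane) (j : Fin 2) (f g : Plane → ℂ) : Prop :=
  ∀ k, coef θ k g = Complex.I * freq θ k j * coef θ k f

/-- Integration by parts over the cell. -/
lemma IsPartial.integral_mul_conj {θ : Plane} {j : Fin 2} {f f' g g' : Plane → ℂ}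
    (hf : SqInt f) (hf' : SqInt f') (hg : SqInt g) (hg' : SqInt g')
    (h : IsPartial θ j f f') (h' : IsPartial θ j g g') :
    ∫ y in cell, f y * conj (g' y) = -∫ y in cell, f' y * conj (g y) := by
  rw [← (hasSum_coef_mul_conj θ hf hg').tsum_eq, ← (hasSum_coef_mul_conj θ hf' hg).tsum_eq,
    ← tsum_neg]
  congr 1
  ext k
  rw [h k, h' k]
  simp only [map_mul, Complex.conj_I, Complex.conj_ofReal]
  ring

/-- Weak derivatives commute. -/
lemma IsPartial.integral_mul_conj_comm {θ : Plane} {j l : Fin 2} {f fj fl g gj gl : Plane → ℂ}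
    (hfj : SqInt fj) (hfl : SqInt fl) (hgj : SqInt gj) (hgl : SqInt gl)
    (h : IsPartial θ j f fj) (h' : IsPartial θ l f fl)
    (i : IsPartial θ j g gj) (i' : IsPartial θ l g gl) :
    ∫ y in cell, fj y * conj (gl y) = ∫ y in cell, fl y * conj (gj y) := by
  rw [← (hasSum_coef_mul_conj θ hfj hgl).tsum_eq, ← (hasSum_coef_mul_conj θ hfl hgj).tsum_eq]
  congr 1
  ext k
  rw [h k, h' k, i k, i' k]
  simp only [map_mul, Complex.conj_I, Complex.conj_ofReal]
  ring

lemma hasFDerivAt_char (θ : Plane) (k : ℤ × ℤ) (y : Plane) :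
    HasFDerivAt (char θ k) (char θ k y • Complex.I •
      ((freq θ k 0 : ℂ) • Complex.ofRealCLM.comp (ContinuousLinearMap.fst ℝ ℝ ℝ) +
        (freq θ k 1 : ℂ) • Complex.ofRealCLM.comp (ContinuousLinearMap.snd ℝ ℝ ℝ))) y := by
  have h1 : HasFDerivAt (fun y : Plane => (y.1 : ℂ))
      (Complex.ofRealCLM.comp (ContinuousLinearMap.fst ℝ ℝ ℝ)) y :=
    (Complex.ofRealCLM.comp (ContinuousLinearMap.fst ℝ ℝ ℝ)).hasFDerivAt
  have h2 : HasFDerivAt (fun y : Plane => (y.2 : ℂ))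
      (Complex.ofRealCLM.comp (ContinuousLinearMap.snd ℝ ℝ ℝ)) y :=
    (Complex.ofRealCLM.comp (ContinuousLinearMap.snd ℝ ℝ ℝ)).hasFDerivAt
  have h := ((((h1.const_mul (freq θ k 0 : ℂ)).add (h2.const_mul (freq θ k 1 : ℂ))).const_mul
    Complex.I).cexp).const_mul (2 * Real.pi : ℂ)⁻¹
  exact HasFDerivAt.congr_fderiv (f := char θ k) h (smul_smul _ _ _)

lemma fderiv_char (θ : Plane) (k : ℤ × ℤ) (y : Plane) (j : Fin 2) :
    fderiv ℝ (char θ k) y (axis j) = Complex.I * freq θ k j * char θ k y := by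
  rw [(hasFDerivAt_char θ k y).fderiv]
  fin_cases j <;> simp [axis] <;> ring

lemma integral_fderiv_of_periodic {F : Plane → ℂ} (hF : ContDiff ℝ (⊤ : ℕ∞) F)
    (hp : QuasiPeriodic 0 F) (j : Fin 2) : ∫ y in cell, fderiv ℝ F y (axis j) = 0 := by
  have hpi := Real.pi_pos
  have hcell : cell =ᵐ[volume] (Icc (-Real.pi, -Real.pi) (Real.pi, Real.pi) : Set Plane) := by
    rw [← Icc_prod_Icc]
    exact Measure.set_prod_ae_eq Ico_ae_eq_Icc Ico_ae_eq_Icc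
  have hd : ∀ y, HasFDerivAt F (fderiv ℝ F y) y := fun y =>
    (hF.differentiable (by simp) y).hasFDerivAt
  have hc : ∀ e : Plane, Continuous fun y => fderiv ℝ F y e := fun e =>
    (hF.continuous_fderiv (by simp)).clm_apply continuous_const
  have hz : ∀ y : Plane, HasFDerivAt (fun _ : Plane => (0 : ℂ)) (0 : Plane →L[ℝ] ℂ) y := fun y =>
    hasFDerivAt_const _ _
  have hle : ((-Real.pi, -Real.pi) : Plane) ≤ (Real.pi, Real.pi) :=
    ⟨by simp only; linarith, by simp only; linarith⟩
  have hp1 : ∀ x : ℝ, F (Real.pi, x) = F (-Real.pi, x) := by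
    intro x
    have := (hp (-Real.pi, x)).1
    simp only [Prod.mk_add_mk, add_zero, Prod.fst_zero, Complex.ofReal_zero, mul_zero,
      Complex.exp_zero, one_smul] at this
    rw [← this]
    congr 2
    ring
  have hp2 : ∀ x : ℝ, F (x, Real.pi) = F (x, -Real.pi) := by
    intro x
    have := (hp (x, -Real.pi)).2
    simp only [Prod.mk_add_mk, add_zero, Prod.snd_zero, Complex.ofReal_zero, mul_zero,
      Complex.exp_zero, one_smul] at this
    rw [← this]
    congr 2
    ring
  rw [setIntegral_congr_set hcell]
  fin_cases j
  · have := integral_divergence_prod_Icc_of_hasFDerivAt_of_le F (fun _ => 0) (fderiv ℝ F)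
      (fun _ => 0) _ _ hle hF.continuous.continuousOn continuousOn_const (fun y _ => hd y)
      (fun y _ => hz y) (by
        simp only [_root_.zero_apply, add_zero]
        exact (hc _).continuousOn.integrableOn_compact isCompact_Icc)
    simpa [hp1, axis] using this
  · have := integral_divergence_prod_Icc_of_hasFDerivAt_of_le (fun _ => 0) F (fun _ => 0)
      (fderiv ℝ F) _ _ hle continuousOn_const hF.continuous.continuousOn (fun y _ => hz y)
      (fun y _ => hd y) (by
        simp only [_root_.zero_apply, zero_add]
        exact (hc _).continuousOn.integrableOn_compact isCompact_Icc)
    simpa [hp2, axis] using this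

lemma exp_two_pi_I_mul_conj (a : ℝ) :
    Complex.exp (2 * Real.pi * Complex.I * a) * conj (Complex.exp (2 * Real.pi * Complex.I * a))
      = 1 := by
  rw [← Complex.exp_conj, ← Complex.exp_add]
  simp [map_ofNat]

/-- A smooth quasi-periodic function is weakly differentiable. -/
lemma isPartial_fderiv {θ : Plane} {φ : Plane → ℂ} (hφ : ContDiff ℝ (⊤ : ℕ∞) φ)
    (hq : QuasiPeriodic θ φ) (j : Fin 2) :
    IsPartial θ j φ fun y => fderiv ℝ φ y (axis j) := by
  intro k
  have hcc : ContDiff ℝ (⊤ : ℕ∞) fun y => conj (char θ k y) :=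
    Complex.conjCLE.contDiff.comp (contDiff_char θ k)
  have hp : QuasiPeriodic 0 fun y => φ y * conj (char θ k y) := by
    intro y
    have h1 := hq y
    have h2 := quasiPeriodic_char θ k y
    simp only [smul_eq_mul] at h1 h2
    simp only [h1, h2, map_mul, smul_eq_mul, Prod.fst_zero, Prod.snd_zero, Complex.ofReal_zero,
      mul_zero, Complex.exp_zero]
    constructor
    · linear_combination (φ y * conj (char θ k y)) * exp_two_pi_I_mul_conj θ.1
    · linear_combination (φ y * conj (char θ k y)) * exp_two_pi_I_mul_conj θ.2
  have hd : ∀ y, fderiv ℝ (fun y => φ y * conj (char θ k y)) y (axis j) =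
      fderiv ℝ φ y (axis j) * conj (char θ k y) +
        (-(Complex.I * freq θ k j)) * (φ y * conj (char θ k y)) := by
    intro y
    have h1 := (hφ.differentiable (by simp) y).hasFDerivAt
    have h2 : HasFDerivAt (fun y => conj (char θ k y))
        ((Complex.conjCLE : ℂ →L[ℝ] ℂ).comp (fderiv ℝ (char θ k) y)) y :=
      (Complex.conjCLE : ℂ →L[ℝ] ℂ).hasFDerivAt.comp y
        (hasFDerivAt_char θ k y).differentiableAt.hasFDerivAt
    have h3 : ((Complex.conjCLE : ℂ →L[ℝ] ℂ).comp (fderiv ℝ (char θ k) y)) (axis j) =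
        conj (Complex.I * freq θ k j * char θ k y) := congrArg conj (fderiv_char θ k y j)
    have h4 : HasFDerivAt (fun y => φ y * conj (char θ k y)) _ y := h1.mul h2
    rw [h4.fderiv]
    change φ y * ((Complex.conjCLE : ℂ →L[ℝ] ℂ).comp (fderiv ℝ (char θ k) y)) (axis j) +
      conj (char θ k y) * fderiv ℝ φ y (axis j) = _
    rw [h3]
    simp only [map_mul, Complex.conj_I, Complex.conj_ofReal]
    ring
  have h0 := integral_fderiv_of_periodic (hφ.mul hcc) hp j
  simp only [hd] at h0
  rw [integral_add (integrable_mul_conj (memLp_fderiv hφ _) (sqInt_char θ k))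
    ((integrable_mul_conj (memLp_of_continuous hφ.continuous) (sqInt_char θ k)).const_mul _),
    integral_const_mul] at h0
  unfold coef
  linear_combination h0

/-- The weak derivatives in the sense of test functions are those in the sense of Fourier
coefficients. -/
lemma hasPartial_iff {θ : Plane} {j : Fin 2} {u g : L2} :
    HasPartial θ j u g ↔ ∀ i, IsPartial θ j (fun y => u y i) (fun y => g y i) := by
  constructor
  · intro h i k
    have h1 := h (char θ k) (contDiff_char θ k) (quasiPeriodic_char θ k) i
    simp only [fderiv_char, map_mul, Complex.conj_I, Complex.conj_ofReal] at h1
    have h2 : ∫ y in cell, u y i * (-Complex.I * freq θ k j * conj (char θ k y)) =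
        (-Complex.I * freq θ k j) * coef θ k fun y => u y i := by
      rw [coef, ← integral_const_mul]
      congr 1
      ext y
      ring
    rw [h2] at h1
    unfold coef at h1 ⊢
    linear_combination h1
  · intro h φ hφ hq i
    exact IsPartial.integral_mul_conj (memLp_coord u i) (memLp_coord g i)
      (memLp_of_continuous hφ.continuous) (memLp_fderiv hφ _) (h i) (isPartial_fderiv hφ hq j)

lemma isPartial_partialD {θ : Plane} {u : L2} (hu : u ∈ H1 θ) (i j : Fin 2) :
    IsPartial θ j (fun y => u y i) (fun y => grad θ u i y j) :=
  hasPartial_iff.1 (hasPartial_partialD hu j) i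

/-! ### Solvability of the div-curl system -/

lemma freq_zero (θ : Plane) (k : ℤ × ℤ) : freq θ k 0 = θ.1 + k.1 := rfl

lemma freq_one (θ : Plane) (k : ℤ × ℤ) : freq θ k 1 = θ.2 + k.2 := rfl

lemma one_le_four_mul_sq {t : ℝ} (ht : t ∈ Ico (-(1 / 2) : ℝ) (1 / 2)) {m : ℤ} (hm : m ≠ 0) :
    1 ≤ 4 * (t + m) ^ 2 := by
  have h : (1 : ℝ) ≤ |(m : ℝ)| := by exact_mod_cast Int.one_le_abs hm
  rcases le_abs'.1 h with h | h <;> nlinarith [ht.1, ht.2]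

/-- The frequencies `k + θ` other than zero are bounded away from zero. -/
lemma exists_pos_le_sq_freq {θ : Plane} (hθ : θ ∈ dualCell) :
    ∃ δ > 0, ∀ k, (k = 0 ∧ θ = 0) ∨ δ ≤ freq θ k 0 ^ 2 + freq θ k 1 ^ 2 := by
  have key : ∀ k : ℤ × ℤ, k ≠ 0 → 1 / 4 ≤ freq θ k 0 ^ 2 + freq θ k 1 ^ 2 := by
    intro k hk
    rw [freq_zero, freq_one]
    by_cases h1 : k.1 = 0
    · have h2 : k.2 ≠ 0 := fun h2 => hk (Prod.ext h1 h2)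
      nlinarith [one_le_four_mul_sq hθ.2 h2, sq_nonneg (θ.1 + k.1)]
    · nlinarith [one_le_four_mul_sq hθ.1 h1, sq_nonneg (θ.2 + k.2)]
  by_cases h0 : θ = 0
  · refine ⟨1 / 4, by norm_num, fun k => ?_⟩
    by_cases hk : k = 0
    · exact Or.inl ⟨hk, h0⟩
    · exact Or.inr (key k hk)
  · have hpos : 0 < θ.1 ^ 2 + θ.2 ^ 2 := by
      rcases not_and_or.1 (fun h : θ.1 = 0 ∧ θ.2 = 0 => h0 (Prod.ext h.1 h.2)) with h | h
      · nlinarith [sq_nonneg θ.2, sq_pos_of_ne_zero h]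
      · nlinarith [sq_nonneg θ.1, sq_pos_of_ne_zero h]
    refine ⟨min (1 / 4) (θ.1 ^ 2 + θ.2 ^ 2), lt_min (by norm_num) hpos, fun k => Or.inr ?_⟩
    by_cases hk : k = 0
    · subst hk
      simp [freq_zero, freq_one]
    · exact (min_le_left _ _).trans (key k hk)

lemma coef_zero_zero (f : Plane → ℂ) :
    coef 0 0 f = (2 * Real.pi : ℂ)⁻¹ * ∫ y in cell, f y := by
  rw [coef, ← integral_const_mul]
  congr 1
  ext y
  simp [char, freq_zero, freq_one, map_ofNat]
  ring

/-- The system `curl φ = f₀`, `div φ = f₁` has a quasi-periodic solution `φ ∈ H¹`; for `θ = 0` the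
means of the right-hand sides have to vanish. In Fourier space it reads
`i (ξ₁ φ₂ - ξ₂ φ₁) = f₀`, `i (ξ₁ φ₁ + ξ₂ φ₂) = f₁`, a system with determinant `|ξ|²`. -/
lemma exists_curl_div_eq {θ : Plane} (hθ : θ ∈ dualCell) {f : Fin 2 → Plane → ℂ}
    (hf : ∀ i, SqInt (f i)) (hmean : θ = 0 → ∀ i, ∫ y in cell, f i y = 0) :
    ∃ φ ∈ H1 θ, ∀ᵐ y ∂volume.restrict cell, curl θ φ y = f 0 y ∧ div θ φ y = f 1 y := by
  obtain ⟨δ, hδ, hfreq⟩ := exists_pos_le_sq_freq hθ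
  set N : ℤ × ℤ → ℝ := fun k => freq θ k 0 ^ 2 + freq θ k 1 ^ 2 with hN
  -- the Fourier coefficients of the solution; they vanish at `ξ = 0`, where the division is by zero
  let a : Fin 2 → ℤ × ℤ → ℂ := ![
    fun k => -Complex.I * (freq θ k 0 * coef θ k (f 1) - freq θ k 1 * coef θ k (f 0)) / N k,
    fun k => -Complex.I * (freq θ k 0 * coef θ k (f 0) + freq θ k 1 * coef θ k (f 1)) / N k]
  have hNpos : ∀ k, 0 ≤ N k := fun k => by positivity
  have hle : ∀ k j, |freq θ k j| ≤ Real.sqrt (N k) := by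
    intro k j
    refine Real.abs_le_sqrt ?_
    fin_cases j
    · exact le_add_of_nonneg_right (sq_nonneg _)
    · exact le_add_of_nonneg_left (sq_nonneg _)
  have ha : ∀ i k, ‖a i k‖ ≤
      (Real.sqrt (N k) / N k) * (‖coef θ k (f 0)‖ + ‖coef θ k (f 1)‖) := by
    intro i k
    have hb : ∀ j l, ‖(freq θ k j : ℂ) * coef θ k (f l)‖ ≤
        Real.sqrt (N k) * ‖coef θ k (f l)‖ := fun j l => by
      rw [norm_mul, Complex.norm_real, Real.norm_eq_abs]
      exact mul_le_mul_of_nonneg_right (hle k j) (norm_nonneg _)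
    rw [div_mul_eq_mul_div]
    fin_cases i
    · simp only [a, Fin.zero_eta, Matrix.cons_val_zero, norm_div, norm_mul, norm_neg,
        Complex.norm_I, one_mul, Complex.norm_real, Real.norm_eq_abs, abs_of_nonneg (hNpos k)]
      refine div_le_div_of_nonneg_right ?_ (hNpos k)
      refine (norm_sub_le _ _).trans ?_
      linarith [hb 0 1, hb 1 0]
    · simp only [a, Fin.mk_one, Matrix.cons_val_one, Matrix.cons_val_fin_one, norm_div, norm_mul,
        norm_neg, Complex.norm_I, one_mul, Complex.norm_real, Real.norm_eq_abs,
        abs_of_nonneg (hNpos k)]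
      refine div_le_div_of_nonneg_right ?_ (hNpos k)
      refine (norm_add_le _ _).trans ?_
      linarith [hb 0 0, hb 1 1]
  have hsqrt : ∀ k, Real.sqrt (N k) / N k ≤ (Real.sqrt δ)⁻¹ := by
    intro k
    rw [Real.sqrt_div_self]
    rcases hfreq k with ⟨rfl, rfl⟩ | h
    · simp [hN, freq_zero, freq_one]
    · exact inv_anti₀ (Real.sqrt_pos.2 hδ) (Real.sqrt_le_sqrt h)
  have hda : ∀ i j k, ‖Complex.I * freq θ k j * a i k‖ ≤
      1 * (‖coef θ k (f 0)‖ + ‖coef θ k (f 1)‖) := by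
    intro i j k
    rw [norm_mul, norm_mul, Complex.norm_I, one_mul, Complex.norm_real, Real.norm_eq_abs]
    refine (mul_le_mul (hle k j) (ha i k) (norm_nonneg _) (Real.sqrt_nonneg _)).trans ?_
    rw [← mul_assoc]
    refine mul_le_mul_of_nonneg_right ?_ (by positivity)
    rw [mul_div_assoc', Real.mul_self_sqrt (hNpos k)]
    exact div_self_le_one _
  choose u hu hua using fun i => exists_sqInt_coef_eq θ (hf 0) (hf 1) (c := a i)
    (C := (Real.sqrt δ)⁻¹) fun k => (ha i k).trans
      (mul_le_mul_of_nonneg_right (hsqrt k) (by positivity))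
  choose du hdu hdua using fun i j => exists_sqInt_coef_eq θ (hf 0) (hf 1) (hda i j)
  obtain ⟨φ, hφ⟩ := exists_field hu
  choose g hg using fun j => exists_field (f := fun i => du i j) fun i => hdu i j
  have hpart : ∀ j, HasPartial θ j φ (g j) := by
    intro j
    rw [hasPartial_iff]
    intro i k
    rw [coef_congr θ k ((hg j).mono fun y hy => hy i), coef_congr θ k (hφ.mono fun y hy => hy i),
      hdua, hua]
  have hcoef : ∀ k, coef θ k (f 0) = Complex.I * freq θ k 0 * a 1 k +
      (-1) * (Complex.I * freq θ k 1 * a 0 k) ∧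
      coef θ k (f 1) = Complex.I * freq θ k 0 * a 0 k + Complex.I * freq θ k 1 * a 1 k := by
    intro k
    by_cases hk : N k = 0
    · rcases hfreq k with ⟨rfl, rfl⟩ | h
      · rw [coef_zero_zero, coef_zero_zero, hmean rfl, hmean rfl]
        simp [freq_zero, freq_one]
      · exact absurd hk (hδ.trans_le h).ne'
    · have hk' : (freq θ k 0 : ℂ) ^ 2 + (freq θ k 1 : ℂ) ^ 2 ≠ 0 := by exact_mod_cast hk
      simp only [a, Matrix.cons_val_zero, Matrix.cons_val_one, Matrix.cons_val_fin_one, hN]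
      push_cast
      constructor
      · field_simp
        linear_combination (coef θ k (f 0) *
          ((freq θ k 0 : ℂ) ^ 2 + (freq θ k 1 : ℂ) ^ 2)) * Complex.I_sq
      · field_simp
        linear_combination (coef θ k (f 1) *
          ((freq θ k 0 : ℂ) ^ 2 + (freq θ k 1 : ℂ) ^ 2)) * Complex.I_sq
  have e0 := ae_eq_of_coef (θ := θ) (hf 0) ((hdu 1 0).add ((hdu 0 1).const_mul (-1))) fun k => by
    have := coef_add θ k (hdu 1 0) ((hdu 0 1).const_mul (-1))
    refine Eq.trans ?_ this.symm
    rw [coef_const_mul, hdua, hdua]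
    exact (hcoef k).1
  have e1 := ae_eq_of_coef (θ := θ) (hf 1) ((hdu 0 0).add (hdu 1 1)) fun k => by
    have := coef_add θ k (hdu 0 0) (hdu 1 1)
    refine Eq.trans ?_ this.symm
    rw [hdua, hdua]
    exact (hcoef k).2
  refine ⟨φ, fun j => ⟨g j, hpart j⟩, ?_⟩
  filter_upwards [e0, e1, hg 0, hg 1] with y h0 h1 hg0 hg1
  simp only [curl, div, grad, partialD_eq (hpart 0), partialD_eq (hpart 1), hg0, hg1, h0, h1,
    Pi.add_apply, and_true]
  ring

/-! ### Sesquilinear pairings over the cell -/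

/-- The inner product of `L²(□)`. -/
def ip (f g : Plane → ℂ) : ℂ := ∫ y in cell, f y * conj (g y)

lemma ip_add_left {f g h : Plane → ℂ} (hf : SqInt f) (hg : SqInt g) (hh : SqInt h) :
    ip (f + g) h = ip f h + ip g h := by
  simp only [ip, Pi.add_apply, add_mul]
  exact integral_add (integrable_mul_conj hf hh) (integrable_mul_conj hg hh)

lemma ip_add_right {f g h : Plane → ℂ} (hf : SqInt f) (hg : SqInt g) (hh : SqInt h) :
    ip f (g + h) = ip f g + ip f h := by
  simp only [ip, Pi.add_apply, map_add, mul_add]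
  exact integral_add (integrable_mul_conj hf hg) (integrable_mul_conj hf hh)

lemma ip_smul_left (a : ℂ) (f g : Plane → ℂ) : ip (a • f) g = a * ip f g := by
  simp only [ip, Pi.smul_apply, smul_eq_mul, mul_assoc]
  exact integral_const_mul _ _

lemma ip_neg_left (f g : Plane → ℂ) : ip (-f) g = -ip f g := by
  simp only [ip, Pi.neg_apply, neg_mul]
  exact integral_neg _

lemma ip_sub_right {f g h : Plane → ℂ} (hf : SqInt f) (hg : SqInt g) (hh : SqInt h) :
    ip f (g - h) = ip f g - ip f h := by
  simp only [ip, Pi.sub_apply, map_sub, mul_sub]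
  exact integral_sub (integrable_mul_conj hf hg) (integrable_mul_conj hf hh)

lemma ip_sub_left {f g h : Plane → ℂ} (hf : SqInt f) (hg : SqInt g) (hh : SqInt h) :
    ip (f - g) h = ip f h - ip g h := by
  simp only [ip, Pi.sub_apply, sub_mul]
  exact integral_sub (integrable_mul_conj hf hh) (integrable_mul_conj hg hh)

lemma ip_congr_left {f g : Plane → ℂ} (h : Plane → ℂ)
    (hfg : ∀ᵐ y ∂volume.restrict cell, f y = g y) : ip f h = ip g h := by
  refine integral_congr_ae ?_
  filter_upwards [hfg] with y hy
  rw [hy]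

lemma sqInt_grad (θ : Plane) (u : L2) (i j : Fin 2) : SqInt fun y => grad θ u i y j :=
  Fibre.memLp_grad θ u i j subset_rfl

lemma sqInt_curl (θ : Plane) (u : L2) : SqInt (curl θ u) :=
  (sqInt_grad θ u 1 0).sub (sqInt_grad θ u 0 1)

lemma sqInt_div (θ : Plane) (u : L2) : SqInt (div θ u) :=
  (sqInt_grad θ u 0 0).add (sqInt_grad θ u 1 1)

lemma ip_curl_right (θ : Plane) (u : L2) {f : Plane → ℂ} (hf : SqInt f) :
    ip f (curl θ u) = ip f (fun y => grad θ u 1 y 0) - ip f (fun y => grad θ u 0 y 1) :=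
  ip_sub_right hf (sqInt_grad θ u 1 0) (sqInt_grad θ u 0 1)

lemma ip_div_right (θ : Plane) (u : L2) {f : Plane → ℂ} (hf : SqInt f) :
    ip f (div θ u) = ip f (fun y => grad θ u 0 y 0) + ip f (fun y => grad θ u 1 y 1) :=
  ip_add_right hf (sqInt_grad θ u 0 0) (sqInt_grad θ u 1 1)

lemma ip_curl_left (θ : Plane) (u : L2) {f : Plane → ℂ} (hf : SqInt f) :
    ip (curl θ u) f = ip (fun y => grad θ u 1 y 0) f - ip (fun y => grad θ u 0 y 1) f :=
  ip_sub_left (sqInt_grad θ u 1 0) (sqInt_grad θ u 0 1) hf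

lemma ip_div_left (θ : Plane) (u : L2) {f : Plane → ℂ} (hf : SqInt f) :
    ip (div θ u) f = ip (fun y => grad θ u 0 y 0) f + ip (fun y => grad θ u 1 y 1) f :=
  ip_add_left (sqInt_grad θ u 0 0) (sqInt_grad θ u 1 1) hf

/-- A gradient is orthogonal to `∇^⊥` of a quasi-periodic function, so that only `∇ φ₂` survives in
the pairing of `∇ v₂` with `(curl φ, div φ) = ∇ φ₂ + ∇^⊥ φ₁`. -/
lemma ip_grad_curl_div {θ : Plane} {v φ : L2} (hv : v ∈ H1 θ) (hφ : φ ∈ H1 θ) :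
    ip (fun y => grad θ v 1 y 0) (curl θ φ) + ip (fun y => grad θ v 1 y 1) (div θ φ) =
      ip (fun y => grad θ v 1 y 0) (fun y => grad θ φ 1 y 0) +
        ip (fun y => grad θ v 1 y 1) (fun y => grad θ φ 1 y 1) := by
  rw [ip_curl_right θ φ (sqInt_grad θ v 1 0), ip_div_right θ φ (sqInt_grad θ v 1 1)]
  have h : ip (fun y => grad θ v 1 y 0) (fun y => grad θ φ 0 y 1) =
      ip (fun y => grad θ v 1 y 1) (fun y => grad θ φ 0 y 0) :=
    IsPartial.integral_mul_conj_comm (sqInt_grad θ v 1 0) (sqInt_grad θ v 1 1)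
      (sqInt_grad θ φ 0 0) (sqInt_grad θ φ 0 1) (isPartial_partialD hv 1 0)
      (isPartial_partialD hv 1 1) (isPartial_partialD hφ 0 0) (isPartial_partialD hφ 0 1)
  linear_combination -h

lemma ip_grad_right {θ : Plane} {q φ : L2} (hq : q ∈ H1 θ) (hφ : φ ∈ H1 θ) (i l j : Fin 2) :
    ip (fun y => q y i) (fun y => grad θ φ l y j) = -ip (fun y => grad θ q i y j) fun y => φ y l :=
  IsPartial.integral_mul_conj (memLp_coord q i) (sqInt_grad θ q i j) (memLp_coord φ l)
    (sqInt_grad θ φ l j) (isPartial_partialD hq i j) (isPartial_partialD hφ l j)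

/-- The operator `φ ↦ (curl φ, div φ)` is skew-symmetric. -/
lemma ip_curl_div {θ : Plane} {q φ : L2} (hq : q ∈ H1 θ) (hφ : φ ∈ H1 θ) :
    ip (fun y => q y 0) (curl θ φ) + ip (fun y => q y 1) (div θ φ) =
      -(ip (curl θ q) (fun y => φ y 0) + ip (div θ q) fun y => φ y 1) := by
  rw [ip_curl_right θ φ (memLp_coord q 0), ip_div_right θ φ (memLp_coord q 1),
    ip_curl_left θ q (memLp_coord φ 0), ip_div_left θ q (memLp_coord φ 1)]
  simp only [ip_grad_right hq hφ]
  ring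

lemma ae_eq_zero_of_integral_normSq {μ : Measure Plane} {f g : Plane → ℂ} (hf : MemLp f 2 μ)
    (hg : MemLp g 2 μ) (h : ∫ y, (f y * conj (f y) + g y * conj (g y)) ∂μ = 0) :
    ∀ᵐ y ∂μ, f y = 0 ∧ g y = 0 := by
  have e : ∀ y, f y * conj (f y) + g y * conj (g y) = ((‖f y‖ ^ 2 + ‖g y‖ ^ 2 : ℝ) : ℂ) := by
    intro y
    simp [Complex.mul_conj, Complex.normSq_eq_norm_sq]
  simp only [e] at h
  have hint : Integrable (fun y => ‖f y‖ ^ 2 + ‖g y‖ ^ 2) μ :=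
    hf.norm.integrable_sq.add hg.norm.integrable_sq
  rw [integral_complex_ofReal, Complex.ofReal_eq_zero, integral_eq_zero_iff_of_nonneg
    (fun y => by positivity) hint] at h
  filter_upwards [h] with y hy
  simp only [Pi.zero_apply] at hy
  have h1 : ‖f y‖ ^ 2 = 0 := by nlinarith [sq_nonneg ‖f y‖, sq_nonneg ‖g y‖]
  have h2 : ‖g y‖ ^ 2 = 0 := by nlinarith [sq_nonneg ‖f y‖, sq_nonneg ‖g y‖]
  exact ⟨by simpa using h1, by simpa using h2⟩

/-- Constant fields are periodic and have vanishing derivatives. -/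
lemma exists_const_field (a : Fin 2 → ℂ) :
    ∃ φ : L2, (∀ᵐ y ∂volume.restrict cell, ∀ i, φ y i = a i) ∧ ∀ j, HasPartial 0 j φ 0 := by
  obtain ⟨φ, hφ⟩ := exists_field (f := fun i _ => a i) fun i => memLp_of_continuous continuous_const
  refine ⟨φ, hφ, fun j => ?_⟩
  rw [hasPartial_iff]
  intro i k
  have h := isPartial_fderiv (θ := 0) (φ := fun _ => a i) contDiff_const
    (fun y => by simp) j k
  rw [coef_congr 0 k (hφ.mono fun y hy => hy i), ← h]
  refine coef_congr 0 k ?_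
  filter_upwards [coord_zero i] with y hy
  rw [hy]
  simp

/-- For `θ = 0`, solutions of the div-curl system can be adjusted by a constant so as to have
prescribed means over a subset of the cell. -/
lemma exists_curl_div_eq_of_mean {θ : Plane} (hθ : θ ∈ dualCell) {f : Fin 2 → Plane → ℂ}
    (hf : ∀ i, SqInt (f i)) (hmean : θ = 0 → ∀ i, ∫ y in cell, f i y = 0)
    {s : Set Plane} (hs : s ⊆ cell) {g : Fin 2 → Plane → ℂ} (hg : ∀ i, IntegrableOn (g i) s)
    {κ : ℂ} (hκ : κ ≠ 0) :
    ∃ φ ∈ H1 θ, (∀ᵐ y ∂volume.restrict cell, curl θ φ y = f 0 y ∧ div θ φ y = f 1 y) ∧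
      (θ = 0 → ∀ i, ∫ y in s, (g i y + κ * φ y i) = 0) := by
  obtain ⟨φ, hφ, hcd⟩ := exists_curl_div_eq hθ hf hmean
  by_cases h0 : θ = 0
  · subst h0
    have hφs : ∀ i, IntegrableOn (fun y => φ y i) s := fun i =>
      IntegrableOn.mono_set ((memLp_coord φ i).integrable (by norm_num)) hs
    have hle : volume.restrict s ≤ volume.restrict cell := Measure.restrict_mono hs le_rfl
    -- the constant that cancels the mean over `s`; if `s` is a null set there is nothing to cancel
    obtain ⟨a, ha, hda⟩ := exists_const_field
      fun i => -(κ * volume.real s)⁻¹ * ∫ y in s, (g i y + κ * φ y i)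
    have haH : a ∈ H1 0 := fun j => ⟨0, hda j⟩
    refine ⟨φ + a, add_mem hφ haH, ?_, fun _ i => ?_⟩
    · filter_upwards [hcd, Fibre.grad_add hφ haH subset_rfl, coord_zero 0, coord_zero 1]
        with y hy h h0 h1
      have hz : ∀ i j, grad 0 a i y j = 0 := by
        intro i j
        fin_cases i
        · simp only [grad, partialD_eq (hda j)]
          exact h0
        · simp only [grad, partialD_eq (hda j)]
          exact h1
      simp only [curl, div, h, hz, add_zero] at hy ⊢
      exact hy
    · have e : ∫ y in s, (g i y + κ * (φ + a) y i) = ∫ y in s, ((g i y + κ * φ y i) +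
          κ * (-(κ * volume.real s)⁻¹ * ∫ y in s, (g i y + κ * φ y i))) := by
        refine integral_congr_ae ?_
        filter_upwards [ae_mono hle ha, ae_mono hle (coord_add φ a i)] with y h1 h2
        rw [h2, h1]
        ring
      have hfin : volume s ≠ ⊤ := by
        refine ((measure_mono hs).trans_lt ?_).ne
        simpa using measure_lt_top (volume.restrict cell) univ
      have hconst : ∀ c : ℂ, IntegrableOn (fun _ => c) s := fun c => integrableOn_const hfin
      have hadd : IntegrableOn (fun y => g i y + κ * φ y i) s := (hg i).add ((hφs i).const_mul κ)
      rw [e, integral_add hadd (hconst _), setIntegral_const]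
      by_cases hvol : volume.real s = 0
      · have h2 : volume.restrict s = 0 := by
          rw [Measure.restrict_eq_zero]
          exact ((ENNReal.toReal_eq_zero_iff _).1 hvol).resolve_right hfin
        simp [h2]
      · have hvol' : (volume.real s : ℂ) ≠ 0 := by exact_mod_cast hvol
        rw [Complex.real_smul]
        field_simp
        ring
  · exact ⟨φ, hφ, hcd, fun h => absurd h h0⟩

/-! ### The eigenvalue problem on the cell -/

/-- On the cell the permittivity is `ε₀` in `R` and `1` elsewhere: no other lattice translate of
`R` meets the cell. -/
lemma Fibre.permittivity_of_mem_cell (P : Fibre) {y : Plane} (hy : y ∈ cell) :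
    (P.permittivity y : ℂ) = 1 + P.R.indicator (fun _ => (P.γ : ℂ)) y := by
  have hiff : (∃ z : ℤ × ℤ, y - (2 * Real.pi * z.1, 2 * Real.pi * z.2) ∈ P.R) ↔ y ∈ P.R := by
    constructor
    · rintro ⟨z, hz⟩
      have hmem := P.R_subset hz
      have hpi := Real.pi_pos
      have key : ∀ (t : ℝ) (m : ℤ), t ∈ Ico (-Real.pi) Real.pi →
          t - 2 * Real.pi * m ∈ Ico (-Real.pi) Real.pi → m = 0 := by
        intro t m h1 h2
        have ha : (m : ℝ) < 1 := by
          by_contra hcon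
          have := mul_le_mul_of_nonneg_left (not_lt.1 hcon) hpi.le
          linarith [h1.2, h2.1]
        have hb : (-1 : ℝ) < m := by
          by_contra hcon
          have := mul_le_mul_of_nonneg_left (not_lt.1 hcon) hpi.le
          linarith [h1.1, h2.2]
        have ha' : m < 1 := by exact_mod_cast ha
        have hb' : -1 < m := by exact_mod_cast hb
        omega
      have h0 : z = 0 := Prod.ext (key _ _ hy.1 hmem.1) (key _ _ hy.2 hmem.2)
      subst h0
      simpa [← Prod.zero_eq_mk] using hz
    · intro h
      exact ⟨0, by simpa [← Prod.zero_eq_mk] using h⟩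
  unfold Fibre.permittivity
  by_cases h : y ∈ P.R
  · rw [if_pos (hiff.2 h)]
    simp [h, Fibre.γ]
  · rw [if_neg (mt hiff.1 h)]
    simp [h]

lemma SqInt.indicator {f : Plane → ℂ} (hf : SqInt f) {s : Set Plane} (hs : MeasurableSet s) :
    SqInt (s.indicator f) := MemLp.indicator hs hf

lemma Fibre.ae_permittivity_mul (P : Fibre) (f : Plane → ℂ) :
    ∀ᵐ y ∂volume.restrict cell, f y + P.R.indicator (fun y => (P.γ : ℂ) * f y) y =
      P.permittivity y * f y := by
  filter_upwards [ae_restrict_mem measurableSet_cell] with y hy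
  rw [P.permittivity_of_mem_cell hy]
  by_cases h : y ∈ P.R <;> simp [h]
  ring

lemma Fibre.sqInt_permittivity_mul (P : Fibre) {f : Plane → ℂ} (hf : SqInt f) :
    SqInt fun y => P.permittivity y * f y :=
  SqInt.congr (f := fun y => f y + P.R.indicator (fun y => (P.γ : ℂ) * f y) y)
    (hf.add ((hf.const_mul (P.γ : ℂ)).indicator P.isOpen.measurableSet))
    (P.ae_permittivity_mul f)

lemma Fibre.setIntegral_R_mul_conj (P : Fibre) (f g : Plane → ℂ) :
    ∫ y in P.R, f y * conj (g y) = ip (P.R.indicator f) g := by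
  have h := setIntegral_indicator (μ := volume) (s := cell) (f := fun y => f y * conj (g y))
    P.isOpen.measurableSet
  rw [inter_eq_right.2 P.R_subset] at h
  rw [← h, ip]
  congr 1
  ext y
  by_cases h : y ∈ P.R <;> simp [h]

lemma Fibre.γ_pos (P : Fibre) : 0 < P.γ := sub_pos.2 P.one_lt

lemma Fibre.c_eq (P : Fibre) (u φ : L2) :
    P.c u φ = ip (fun y => u y 0) (fun y => φ y 0) +
      ip (fun y => P.permittivity y * u y 1) (fun y => φ y 1) := by
  have h1 := memLp_coord u 1
  rw [← ip_congr_left _ (P.ae_permittivity_mul fun y => u y 1)]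
  have h2 := ip_add_left (f := fun y => u y 1)
    (g := P.R.indicator fun y => (P.γ : ℂ) * u y 1) h1
    (SqInt.indicator (h1.const_mul (P.γ : ℂ)) P.isOpen.measurableSet) (memLp_coord φ 1)
  refine Eq.trans ?_ (congrArg _ h2.symm)
  rw [← P.setIntegral_R_mul_conj, Fibre.c, ← integral_const_mul]
  simp only [cdot, Fin.sum_univ_two, mul_assoc]
  rw [integral_add (integrable_mul_conj (memLp_coord u 0) (memLp_coord φ 0))
    (integrable_mul_conj h1 (memLp_coord φ 1)), add_assoc]
  rfl

/-- On `V(θ)` the form `b` is the Dirichlet form of the second component plus the `div-curl` form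
on the inclusion: outside `R` the fields satisfy `∇^⊥ u₁ = -∇ u₂`. -/
lemma Fibre.b_eq (P : Fibre) {θ : Plane} {u φ : L2} (hu : u ∈ P.V θ) (hφ : φ ∈ P.V θ) :
    P.b θ u φ = ip (fun y => grad θ u 1 y 0) (fun y => grad θ φ 1 y 0) +
      ip (fun y => grad θ u 1 y 1) (fun y => grad θ φ 1 y 1) +
      (P.γ : ℂ)⁻¹ *
        ∫ y in P.R, (curl θ u y * conj (curl θ φ y) + div θ u y * conj (div θ φ y)) := by
  have hγ : (P.γ : ℂ) ≠ 0 := by exact_mod_cast P.γ_pos.ne'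
  have hR : MeasurableSet P.R := P.isOpen.measurableSet
  let D : Plane → ℂ := fun y => grad θ u 1 y 0 * conj (grad θ φ 1 y 0) +
    grad θ u 1 y 1 * conj (grad θ φ 1 y 1)
  have hD : IntegrableOn D cell :=
    (integrable_mul_conj (sqInt_grad θ u 1 0) (sqInt_grad θ φ 1 0)).add
      (integrable_mul_conj (sqInt_grad θ u 1 1) (sqInt_grad θ φ 1 1))
  have hsplit : ip (fun y => grad θ u 1 y 0) (fun y => grad θ φ 1 y 0) +
      ip (fun y => grad θ u 1 y 1) (fun y => grad θ φ 1 y 1) =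
      (∫ y in cell \ P.R, D y) + ∫ y in P.R, D y := by
    have h := integral_inter_add_sdiff hR hD
    rw [inter_eq_right.2 P.R_subset] at h
    rw [add_comm (∫ y in cell \ P.R, D y), h]
    exact (integral_add (integrable_mul_conj (sqInt_grad θ u 1 0) (sqInt_grad θ φ 1 0))
      (integrable_mul_conj (sqInt_grad θ u 1 1) (sqInt_grad θ φ 1 1))).symm
  have hcd : IntegrableOn (fun y => curl θ u y * conj (curl θ φ y) + div θ u y * conj (div θ φ y))
      P.R := IntegrableOn.mono_set ((integrable_mul_conj (sqInt_curl θ u) (sqInt_curl θ φ)).add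
        (integrable_mul_conj (sqInt_div θ u) (sqInt_div θ φ))) P.R_subset
  have hout : ∫ y in cell \ P.R, (cdot (perp (grad θ u 0 y)) (grad θ φ 1 y) +
      cdot (grad θ u 1 y) (perp (grad θ φ 0 y))) = ∫ y in cell \ P.R, (-2) * D y := by
    refine integral_congr_ae ?_
    filter_upwards [hu.2, hφ.2] with y h1 h2
    simp only [div, curl] at h1 h2
    have e1 : grad θ u 0 y 0 = -grad θ u 1 y 1 := by linear_combination h1.1
    have e2 : grad θ u 0 y 1 = grad θ u 1 y 0 := by linear_combination -h1.2
    have e3 : grad θ φ 0 y 0 = -grad θ φ 1 y 1 := by linear_combination h2.1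
    have e4 : grad θ φ 0 y 1 = grad θ φ 1 y 0 := by linear_combination -h2.2
    simp [cdot, perp, Fin.sum_univ_two, e1, e2, e3, e4, D]
    ring
  have hin : ∀ y, cdot (grad θ u 0 y) (grad θ φ 0 y) + P.ε₀ * cdot (grad θ u 1 y) (grad θ φ 1 y) +
        cdot (perp (grad θ u 0 y)) (grad θ φ 1 y) + cdot (grad θ u 1 y) (perp (grad θ φ 0 y)) =
      (P.γ : ℂ) * D y + (curl θ u y * conj (curl θ φ y) + div θ u y * conj (div θ φ y)) := by
    intro y
    simp [cdot, perp, Fin.sum_univ_two, D, curl, div, Fibre.γ]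
    ring
  rw [Fibre.b, hout, hsplit, integral_const_mul]
  simp only [hin]
  rw [integral_add ((hD.mono_set P.R_subset).const_mul _) hcd, integral_const_mul]
  field_simp
  ring

/-- A field in the kernel of the form `b` is locally constant. -/
lemma Fibre.grad_eq_zero_of_b_self (P : Fibre) {θ : Plane} {u : L2} (hu : u ∈ P.V θ)
    (h : P.b θ u u = 0) : ∀ᵐ y ∂volume.restrict cell, ∀ i j, grad θ u i y j = 0 := by
  have hγ := P.γ_pos
  have hns : ∀ (μ : Measure Plane) (f g : Plane → ℂ),
      ∫ y, (f y * conj (f y) + g y * conj (g y)) ∂μ =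
        ((∫ y, (‖f y‖ ^ 2 + ‖g y‖ ^ 2) ∂μ : ℝ) : ℂ) := by
    intro μ f g
    rw [← integral_complex_ofReal]
    congr 1
    ext y
    simp [Complex.mul_conj, Complex.normSq_eq_norm_sq]
  have hadd : ip (fun y => grad θ u 1 y 0) (fun y => grad θ u 1 y 0) +
      ip (fun y => grad θ u 1 y 1) (fun y => grad θ u 1 y 1) =
      ∫ y in cell, (grad θ u 1 y 0 * conj (grad θ u 1 y 0) +
        grad θ u 1 y 1 * conj (grad θ u 1 y 1)) :=
    (integral_add (integrable_mul_conj (sqInt_grad θ u 1 0) (sqInt_grad θ u 1 0))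
      (integrable_mul_conj (sqInt_grad θ u 1 1) (sqInt_grad θ u 1 1))).symm
  rw [P.b_eq hu hu, hadd] at h
  have hgrad : ∫ y in cell, (grad θ u 1 y 0 * conj (grad θ u 1 y 0) +
        grad θ u 1 y 1 * conj (grad θ u 1 y 1)) = 0 ∧
      ∫ y in P.R, (curl θ u y * conj (curl θ u y) + div θ u y * conj (div θ u y)) = 0 := by
    rw [hns, hns] at h ⊢
    rw [← Complex.ofReal_inv, ← Complex.ofReal_mul, ← Complex.ofReal_add,
      Complex.ofReal_eq_zero] at h
    rw [Complex.ofReal_eq_zero, Complex.ofReal_eq_zero]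
    have h1 : 0 ≤ ∫ y in cell, (‖grad θ u 1 y 0‖ ^ 2 + ‖grad θ u 1 y 1‖ ^ 2) :=
      integral_nonneg fun y => by positivity
    have h2 : 0 ≤ ∫ y in P.R, (‖curl θ u y‖ ^ 2 + ‖div θ u y‖ ^ 2) :=
      integral_nonneg fun y => by positivity
    have h3 := mul_nonneg (inv_pos.2 hγ).le h2
    refine ⟨by linarith, ?_⟩
    have h4 : P.γ⁻¹ * ∫ y in P.R, (‖curl θ u y‖ ^ 2 + ‖div θ u y‖ ^ 2) = 0 := by linarith
    exact (mul_eq_zero.1 h4).resolve_left (inv_pos.2 hγ).ne'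
  have hle : volume.restrict P.R ≤ volume.restrict cell := Measure.restrict_mono P.R_subset le_rfl
  have hz1 := ae_eq_zero_of_integral_normSq (sqInt_grad θ u 1 0) (sqInt_grad θ u 1 1) hgrad.1
  have hz2 := ae_eq_zero_of_integral_normSq ((sqInt_curl θ u).mono_measure hle)
    ((sqInt_div θ u).mono_measure hle) hgrad.2
  have hz3 : ∀ᵐ y ∂volume.restrict cell, curl θ u y = 0 ∧ div θ u y = 0 := by
    rw [← union_sdiff_cancel P.R_subset, ae_restrict_union_iff]
    exact ⟨hz2, hu.2.mono fun y hy => ⟨hy.2, hy.1⟩⟩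
  filter_upwards [hz1, hz3] with y h1 h2 i j
  simp only [curl, div, h1.1, h1.2, zero_sub, add_zero, neg_eq_zero] at h2
  fin_cases i <;> fin_cases j
  exacts [h2.2, h2.1, h1.1, h1.2]

/-- For `θ = 0` constant fields are admissible test fields, so that eigenfunctions to nonzero
eigenvalues have weighted mean zero. -/
lemma Fibre.integral_eq_zero_of_eigen (P : Fibre) {v : L2} (hv : v ∈ P.V 0) {μ : ℂ} (hμ : μ ≠ 0)
    (hb : ∀ φ ∈ P.V 0, P.b 0 v φ = μ * P.c v φ) :
    ∫ y in cell, v y 0 = 0 ∧ ∫ y in cell, P.permittivity y * v y 1 = 0 := by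
  have key : ∀ a : Fin 2 → ℂ, (∫ y in cell, v y 0) * conj (a 0) +
      (∫ y in cell, P.permittivity y * v y 1) * conj (a 1) = 0 := by
    intro a
    obtain ⟨φ, hφ, hd⟩ := exists_const_field a
    have hg : ∀ᵐ y ∂volume.restrict cell, ∀ i j, grad 0 φ i y j = 0 := by
      filter_upwards [coord_zero 0, coord_zero 1] with y h0 h1 i j
      simp only [grad, partialD_eq (hd j)]
      fin_cases i
      exacts [h0, h1]
    have hle : volume.restrict (cell \ P.R) ≤ volume.restrict cell :=
      Measure.restrict_mono sdiff_subset le_rfl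
    have hle' : volume.restrict P.R ≤ volume.restrict cell :=
      Measure.restrict_mono P.R_subset le_rfl
    have hV : φ ∈ P.V 0 := by
      refine ⟨fun j => ⟨0, hd j⟩, ?_⟩
      filter_upwards [ae_mono hle hg] with y hy
      simp [div, curl, hy]
    have h := hb φ hV
    rw [P.b_eq hv hV, P.c_eq] at h
    have z1 : ∀ j f, ip f (fun y => grad 0 φ 1 y j) = 0 := by
      intro j f
      refine integral_eq_zero_of_ae ?_
      filter_upwards [hg] with y hy
      simp [hy]
    have z2 : ∫ y in P.R, (curl 0 v y * conj (curl 0 φ y) + div 0 v y * conj (div 0 φ y)) = 0 := by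
      refine integral_eq_zero_of_ae ?_
      filter_upwards [ae_mono hle' hg] with y hy
      simp [hy, curl, div]
    have z3 : ∀ f i, ip f (fun y => φ y i) = (∫ y in cell, f y) * conj (a i) := by
      intro f i
      rw [ip, ← integral_mul_const]
      refine integral_congr_ae ?_
      filter_upwards [hφ] with y hy
      rw [hy]
    rw [z1, z1, z2, z3, z3] at h
    have h' : μ * ((∫ y in cell, v y 0) * conj (a 0) +
      (∫ y in cell, P.permittivity y * v y 1) * conj (a 1)) = 0 := by
      rw [← h]
      ring
    exact (mul_eq_zero.1 h').resolve_left hμ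
  exact ⟨by simpa using key ![1, 0], by simpa using key ![0, 1]⟩

lemma Fibre.ae_cell_of_ae_R (P : Fibre) {p : Plane → Prop} (h : ∀ᵐ y ∂volume.restrict P.R, p y)
    (h' : ∀ᵐ y ∂volume.restrict (cell \ P.R), p y) : ∀ᵐ y ∂volume.restrict cell, p y := by
  rw [← union_sdiff_cancel P.R_subset, ae_restrict_union_iff]
  exact ⟨h, h'⟩

/-- On the inclusion, the transverse electric field `∇ v₂ / (i ω) + q` is determined by the
longitudinal fields if `(curl q, div q) = -i ω (v₁, ε v₂)`: the defect `G` vanishes. For `θ = 0` the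
additive constant in `q` has to be such that `G` has mean zero over `R`. The proof tests the
eigenvalue equation with the field `φ` such that `(curl φ, div φ)` is the defect on `R` and zero
outside. -/
lemma Fibre.ae_eq_zero_of_eigen (P : Fibre) {θ : Plane} (hθ : θ ∈ dualCell) {ω : ℂ} {v q : L2}
    (hv : v ∈ P.V θ) (hb : ∀ φ ∈ P.V θ, P.b θ v φ = ω ^ 2 * P.c v φ)
    (hq : q ∈ H1 θ)
    (hcurl : ∀ᵐ y ∂volume.restrict cell, curl θ q y = -(Complex.I * ω) * v y 0)
    (hdiv : ∀ᵐ y ∂volume.restrict cell, div θ q y = -(Complex.I * ω) * (P.permittivity y * v y 1))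
    {G : Fin 2 → Plane → ℂ}
    (hG : G = ![fun y => P.γ * grad θ v 1 y 0 + curl θ v y + Complex.I * ω * P.γ * q y 0,
      fun y => P.γ * grad θ v 1 y 1 + div θ v y + Complex.I * ω * P.γ * q y 1])
    (hmean : θ = 0 → ∀ i, ∫ y in P.R, G i y = 0) :
    ∀ᵐ y ∂volume.restrict P.R, G 0 y = 0 ∧ G 1 y = 0 := by
  have hγ : (P.γ : ℂ) ≠ 0 := by exact_mod_cast P.γ_pos.ne'
  have hR : MeasurableSet P.R := P.isOpen.measurableSet
  have hle : volume.restrict P.R ≤ volume.restrict cell := Measure.restrict_mono P.R_subset le_rfl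
  have hS0 : SqInt (fun y => grad θ v 1 y 0 + Complex.I * ω * q y 0) :=
    (sqInt_grad θ v 1 0).add ((memLp_coord q 0).const_mul _)
  have hS1 : SqInt (fun y => grad θ v 1 y 1 + Complex.I * ω * q y 1) :=
    (sqInt_grad θ v 1 1).add ((memLp_coord q 1).const_mul _)
  have hGe0 : G 0 = (P.γ : ℂ) • (fun y => grad θ v 1 y 0 + Complex.I * ω * q y 0) + curl θ v := by
    rw [hG]
    ext y
    simp
    ring
  have hGe1 : G 1 = (P.γ : ℂ) • (fun y => grad θ v 1 y 1 + Complex.I * ω * q y 1) + div θ v := by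
    rw [hG]
    ext y
    simp
    ring
  have hGs : ∀ i, SqInt (G i) := by
    intro i
    fin_cases i
    · simp only [Fin.zero_eta, hGe0]
      exact (hS0.const_mul _).add (sqInt_curl θ v)
    · simp only [Fin.mk_one, hGe1]
      exact (hS1.const_mul _).add (sqInt_div θ v)
  obtain ⟨φ, hφ, hcd⟩ := exists_curl_div_eq hθ (f := fun i => P.R.indicator (G i))
    (fun i => (hGs i).indicator hR) fun h0 i => by
      rw [setIntegral_indicator hR, inter_eq_right.2 P.R_subset]
      exact hmean h0 i
  have hout : ∀ᵐ y ∂volume.restrict (cell \ P.R), div θ φ y = 0 ∧ curl θ φ y = 0 := by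
    have h1 : ∀ᵐ y ∂volume.restrict (cell \ P.R), y ∈ cell \ P.R :=
      ae_restrict_mem (measurableSet_cell.diff hR)
    filter_upwards [h1, ae_mono (Measure.restrict_mono sdiff_subset le_rfl) hcd] with y hy h
    simp only [indicator_of_notMem hy.2] at h
    exact ⟨h.2, h.1⟩
  have hφV : φ ∈ P.V θ := ⟨hφ, hout⟩
  -- pairings with `curl φ` and `div φ` over `R` are pairings over the whole cell
  have hext : ∀ f : Plane → ℂ, ip (P.R.indicator f) (curl θ φ) = ip f (curl θ φ) ∧
      ip (P.R.indicator f) (div θ φ) = ip f (div θ φ) := by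
    intro f
    constructor
    · refine integral_congr_ae ?_
      filter_upwards [hcd] with y h
      by_cases hy : y ∈ P.R
      · simp [hy]
      · simp [h.1, hy]
    · refine integral_congr_ae ?_
      filter_upwards [hcd] with y h
      by_cases hy : y ∈ P.R
      · simp [hy]
      · simp [h.2, hy]
  have hc := sqInt_curl θ φ
  have hd := sqInt_div θ φ
  have hsum : ∀ {f g : Plane → ℂ}, SqInt f → SqInt g →
      ∫ y in P.R, (f y * conj (curl θ φ y) + g y * conj (div θ φ y)) =
        ip f (curl θ φ) + ip g (div θ φ) := by
    intro f g hf hg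
    rw [integral_add (integrable_mul_conj (hf.mono_measure hle) (hc.mono_measure hle))
      (integrable_mul_conj (hg.mono_measure hle) (hd.mono_measure hle)),
      P.setIntegral_R_mul_conj, P.setIntegral_R_mul_conj, (hext f).1, (hext g).2]
  have hbφ := hb φ hφV
  rw [P.b_eq hv hφV, hsum (sqInt_curl θ v) (sqInt_div θ v), P.c_eq] at hbφ
  have hgrad := ip_grad_curl_div hv.1 hφ
  have hibp := ip_curl_div hq hφ
  rw [ip_congr_left _ hcurl, ip_congr_left _ hdiv] at hibp
  have e1 : ip (fun y => -(Complex.I * ω) * v y 0) (fun y => φ y 0) =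
      -(Complex.I * ω) * ip (fun y => v y 0) (fun y => φ y 0) := ip_smul_left _ _ _
  have e2 : ip (fun y => -(Complex.I * ω) * (P.permittivity y * v y 1)) (fun y => φ y 1) =
      -(Complex.I * ω) * ip (fun y => P.permittivity y * v y 1) (fun y => φ y 1) :=
    ip_smul_left _ _ _
  rw [e1, e2] at hibp
  have hpair : ∀ {i : Fin 2} {h : Plane → ℂ}, SqInt h →
      ip (fun y => grad θ v 1 y i + Complex.I * ω * q y i) h =
        ip (fun y => grad θ v 1 y i) h + Complex.I * ω * ip (fun y => q y i) h := by
    intro i h hh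
    rw [← ip_smul_left]
    exact ip_add_left (sqInt_grad θ v 1 i) ((memLp_coord q i).const_mul _) hh
  have hzero : ip (G 0) (curl θ φ) + ip (G 1) (div θ φ) = 0 := by
    have hS0' : SqInt ((P.γ : ℂ) • fun y => grad θ v 1 y 0 + Complex.I * ω * q y 0) :=
      hS0.const_mul _
    have hS1' : SqInt ((P.γ : ℂ) • fun y => grad θ v 1 y 1 + Complex.I * ω * q y 1) :=
      hS1.const_mul _
    rw [hGe0, hGe1, ip_add_left hS0' (sqInt_curl θ v) hc, ip_add_left hS1' (sqInt_div θ v) hd,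
      ip_smul_left, ip_smul_left, hpair hc, hpair hd]
    field_simp at hbφ
    linear_combination hbφ + (P.γ : ℂ) * hgrad + (P.γ : ℂ) * Complex.I * ω * hibp +
      (P.γ : ℂ) * ω ^ 2 * (ip (fun y => v y 0) (fun y => φ y 0) +
        ip (fun y => P.permittivity y * v y 1) (fun y => φ y 1)) * Complex.I_sq
  rw [← hsum (hGs 0) (hGs 1)] at hzero
  refine ae_eq_zero_of_integral_normSq ((hGs 0).mono_measure hle) ((hGs 1).mono_measure hle) ?_
  rw [← hzero]
  refine integral_congr_ae ?_
  filter_upwards [ae_mono hle hcd, ae_restrict_mem hR] with y h hy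
  simp only [indicator_of_mem hy] at h
  rw [h.1, h.2]

/-! ### The time-harmonic Maxwell system on the cell -/

/-- The derivative `∂_j` of the wave with `θ`-quasi-periodic amplitude `F`, tested over the cell
with `φ`; the derivative in the direction of `x₃` is multiplication by `i ω`. -/
def cellDeriv (ω : ℝ) (j : Fin 3) (F φ : Plane → ℂ) : ℂ :=
  ![-ip F (fun y => fderiv ℝ φ y (axis 0)), -ip F (fun y => fderiv ℝ φ y (axis 1)),
    Complex.I * ω * ip F φ] j

/-- The curl of the wave with amplitude `F`, tested over the cell. -/
def cellCurl (ω : ℝ) (F : Plane → Fin 3 → ℂ) (i : Fin 3) (φ : Plane → ℂ) : ℂ :=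
  cellDeriv ω (i + 1) (fun y => F y (i + 2)) φ - cellDeriv ω (i + 2) (fun y => F y (i + 1)) φ

/-- The time-harmonic Maxwell system for the amplitudes `E`, `H`, tested over the cell with smooth
`θ`-quasi-periodic functions. -/
def Fibre.IsCellSolution (P : Fibre) (θ : Plane) (ω : ℝ) (E H : Plane → Fin 3 → ℂ) : Prop :=
  (∀ i, SqInt fun y => E y i) ∧ (∀ i, SqInt fun y => H y i) ∧
  ∀ φ : Plane → ℂ, ContDiff ℝ (⊤ : ℕ∞) φ → QuasiPeriodic θ φ → ∀ i,
    cellCurl ω H i φ = Complex.I * ω * ip (fun y => P.permittivity y * E y i) φ ∧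
    cellCurl ω E i φ = -(Complex.I * ω) * ip (fun y => H y i) φ

lemma ip_fderiv {θ : Plane} {u : L2} (hu : u ∈ H1 θ) (i j : Fin 2) {φ : Plane → ℂ}
    (hφ : ContDiff ℝ (⊤ : ℕ∞) φ) (hq : QuasiPeriodic θ φ) :
    ip (fun y => u y i) (fun y => fderiv ℝ φ y (axis j)) = -ip (fun y => grad θ u i y j) φ :=
  hasPartial_partialD hu j φ hφ hq i

/-- Frequency zero: the longitudinal fields are locally constant and the transverse fields
vanish. -/
lemma Fibre.exists_isCellSolution_zero (P : Fibre) {θ : Plane} {v : L2} (hv : v ∈ P.V θ)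
    (hb : ∀ φ ∈ P.V θ, P.b θ v φ = 0) :
    ∃ E H : Plane → Fin 3 → ℂ, (∀ y, H y 2 = v y 0 ∧ E y 2 = v y 1) ∧
      P.IsCellSolution θ 0 E H := by
  have hg := P.grad_eq_zero_of_b_self hv (hb v hv)
  have hz : SqInt fun _ => 0 := memLp_of_continuous continuous_const
  have hz' : ∀ f, ip (fun _ => 0) f = 0 := fun f => by simp [ip]
  refine ⟨fun y => ![0, 0, v y 1], fun y => ![0, 0, v y 0], fun y => ⟨rfl, rfl⟩, ?_, ?_, ?_⟩
  · intro i
    fin_cases i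
    exacts [hz, hz, memLp_coord v 1]
  · intro i
    fin_cases i
    exacts [hz, hz, memLp_coord v 0]
  · intro φ hφ hq i
    have key : ∀ i j, ip (fun y => v y i) (fun y => fderiv ℝ φ y (axis j)) = 0 := by
      intro i j
      rw [ip_fderiv hv.1 i j hφ hq, neg_eq_zero]
      exact (ip_congr_left φ (hg.mono fun y hy => hy i j)).trans (hz' φ)
    fin_cases i <;> simp [cellCurl, cellDeriv, key, hz', Fin.isValue]

/-- Nonzero frequency: with `q` solving the div-curl system with right-hand side `-i ω (v₁, ε v₂)`,
the transverse fields are `∇ v₂ / (i ω) + q` and `(q₂, -q₁)`. -/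
lemma Fibre.exists_isCellSolution (P : Fibre) {θ : Plane} (hθ : θ ∈ dualCell) {ω : ℝ}
    (hω : ω ≠ 0) {v : L2} (hv : v ∈ P.V θ) (hb : ∀ φ ∈ P.V θ, P.b θ v φ = (ω : ℂ) ^ 2 * P.c v φ) :
    ∃ E H : Plane → Fin 3 → ℂ, (∀ y, H y 2 = v y 0 ∧ E y 2 = v y 1) ∧
      P.IsCellSolution θ ω E H := by
  have hω' : (ω : ℂ) ≠ 0 := by exact_mod_cast hω
  have hI := Complex.I_ne_zero
  have hγ : (P.γ : ℂ) ≠ 0 := by exact_mod_cast P.γ_pos.ne'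
  have hR : MeasurableSet P.R := P.isOpen.measurableSet
  have hg0 : SqInt fun y => P.γ * grad θ v 1 y 0 + curl θ v y :=
    ((sqInt_grad θ v 1 0).const_mul _).add (sqInt_curl θ v)
  have hg1 : SqInt fun y => P.γ * grad θ v 1 y 1 + div θ v y :=
    ((sqInt_grad θ v 1 1).const_mul _).add (sqInt_div θ v)
  have hint : ∀ {f : Plane → ℂ}, SqInt f → IntegrableOn f P.R := fun hf =>
    IntegrableOn.mono_set (MemLp.integrable (by norm_num) hf) P.R_subset
  obtain ⟨q, hq, hcd, hmean⟩ := exists_curl_div_eq_of_mean hθ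
    (f := ![fun y => -(Complex.I * ω) * v y 0,
      fun y => -(Complex.I * ω) * (P.permittivity y * v y 1)])
    (fun i => by
      fin_cases i
      exacts [(memLp_coord v 0).const_mul _,
        (P.sqInt_permittivity_mul (memLp_coord v 1)).const_mul _])
    (fun h0 i => by
      subst h0
      have h := P.integral_eq_zero_of_eigen hv (pow_ne_zero 2 hω') hb
      fin_cases i
      · change ∫ y in cell, -(Complex.I * ω) * v y 0 = 0
        rw [integral_const_mul, h.1, mul_zero]
      · change ∫ y in cell, -(Complex.I * ω) * (P.permittivity y * v y 1) = 0
        rw [integral_const_mul, h.2, mul_zero])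
    P.R_subset
    (g := ![fun y => P.γ * grad θ v 1 y 0 + curl θ v y, fun y => P.γ * grad θ v 1 y 1 + div θ v y])
    (fun i => by
      fin_cases i
      exacts [hint hg0, hint hg1])
    (κ := Complex.I * ω * P.γ) (mul_ne_zero (mul_ne_zero hI hω') hγ)
  simp only [Matrix.cons_val_zero, Matrix.cons_val_one, Matrix.cons_val_fin_one] at hcd
  have hin := P.ae_eq_zero_of_eigen hθ hv hb hq (hcd.mono fun y hy => hy.1)
    (hcd.mono fun y hy => hy.2) rfl (fun h0 i => by
      have h := hmean h0 i
      fin_cases i <;> exact h)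
  simp only [Matrix.cons_val_zero, Matrix.cons_val_one, Matrix.cons_val_fin_one] at hin
  obtain ⟨κ, hκ⟩ : ∃ κ, Complex.I * ω * κ = 1 := ⟨_, mul_inv_cancel₀ (mul_ne_zero hI hω')⟩
  let E : Fin 2 → Plane → ℂ := fun j y => κ * grad θ v 1 y j + q y j
  have hE : ∀ j, SqInt (E j) := fun j =>
    ((sqInt_grad θ v 1 j).const_mul _).add (memLp_coord q j)
  -- the transverse part of `∇ × H = i ω ε E` holds almost everywhere
  have hae : ∀ᵐ y ∂volume.restrict cell,
      grad θ v 0 y 1 + Complex.I * ω * q y 0 = Complex.I * ω * (P.permittivity y * E 0 y) ∧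
      -grad θ v 0 y 0 + Complex.I * ω * q y 1 = Complex.I * ω * (P.permittivity y * E 1 y) := by
    have hEm : ∀ j y, Complex.I * ω * E j y = grad θ v 1 y j + Complex.I * ω * q y j := by
      intro j y
      simp only [E]
      linear_combination grad θ v 1 y j * hκ
    refine P.ae_cell_of_ae_R ?_ ?_
    · filter_upwards [hin, ae_restrict_mem hR] with y hy hyR
      rw [P.permittivity_of_mem_cell (P.R_subset hyR), indicator_of_mem hyR]
      simp only [curl, div] at hy
      constructor
      · linear_combination -hy.1 - (1 + (P.γ : ℂ)) * hEm 0 y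
      · linear_combination -hy.2 - (1 + (P.γ : ℂ)) * hEm 1 y
    · have h1 : ∀ᵐ y ∂volume.restrict (cell \ P.R), y ∈ cell \ P.R :=
        ae_restrict_mem (measurableSet_cell.diff hR)
      filter_upwards [h1, hv.2] with y hy h
      rw [P.permittivity_of_mem_cell hy.1, indicator_of_notMem hy.2]
      simp only [curl, div] at h
      constructor
      · linear_combination -h.2 - hEm 0 y
      · linear_combination -h.1 - hEm 1 y
  refine ⟨fun y => ![E 0 y, E 1 y, v y 1], fun y => ![q y 1, -q y 0, v y 0],
    fun y => ⟨rfl, rfl⟩, ?_, ?_, ?_⟩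
  · intro i
    fin_cases i
    exacts [hE 0, hE 1, memLp_coord v 1]
  · intro i
    fin_cases i
    exacts [memLp_coord q 1, (memLp_coord q 0).neg, memLp_coord v 0]
  · intro φ hφ hqp
    -- tested with `φ`, every equation is a linear combination of the facts collected here
    have hφ2 : SqInt φ := memLp_of_continuous hφ.continuous
    have hd : ∀ j, SqInt fun y => fderiv ℝ φ y (axis j) := fun j => memLp_fderiv hφ _
    have hvD := fun i j => ip_fderiv hv.1 i j hφ hqp
    have hqD := fun i j => ip_fderiv hq i j hφ hqp
    have hEip : ∀ j {h : Plane → ℂ}, SqInt h → ip (E j) h =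
        κ * ip (fun y => grad θ v 1 y j) h + ip (fun y => q y j) h := by
      intro j h hh
      rw [← ip_smul_left]
      exact ip_add_left ((sqInt_grad θ v 1 j).const_mul _) (memLp_coord q j) hh
    have hneg : ∀ h, ip (fun y => -q y 0) h = -ip (fun y => q y 0) h := fun h => ip_neg_left _ _
    have hcomm : ip (fun y => grad θ v 1 y 0) (fun y => fderiv ℝ φ y (axis 1)) =
        ip (fun y => grad θ v 1 y 1) (fun y => fderiv ℝ φ y (axis 0)) :=
      IsPartial.integral_mul_conj_comm (sqInt_grad θ v 1 0) (sqInt_grad θ v 1 1)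
        (hd 0) (hd 1) (isPartial_partialD hv.1 1 0)
        (isPartial_partialD hv.1 1 1) (isPartial_fderiv hφ hqp 0) (isPartial_fderiv hφ hqp 1)
    have hcurl := ip_congr_left φ (hcd.mono fun y hy => hy.1)
    have hdiv := ip_congr_left φ (hcd.mono fun y hy => hy.2)
    have e1 : ip (fun y => -(Complex.I * ω) * v y 0) φ =
        -(Complex.I * ω) * ip (fun y => v y 0) φ := ip_smul_left _ _ _
    have e2 : ip (fun y => -(Complex.I * ω) * (P.permittivity y * v y 1)) φ =
        -(Complex.I * ω) * ip (fun y => P.permittivity y * v y 1) φ := ip_smul_left _ _ _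
    rw [e1, ip_curl_left θ q hφ2] at hcurl
    rw [e2, ip_div_left θ q hφ2] at hdiv
    have hε : ∀ j, ip (fun y => Complex.I * ω * (P.permittivity y * E j y)) φ =
        Complex.I * ω * ip (fun y => P.permittivity y * E j y) φ := fun j => ip_smul_left _ _ _
    have hH0 : ip (fun y => grad θ v 0 y 1 + Complex.I * ω * q y 0) φ =
        ip (fun y => grad θ v 0 y 1) φ + Complex.I * ω * ip (fun y => q y 0) φ := by
      rw [← ip_smul_left]
      exact ip_add_left (sqInt_grad θ v 0 1) ((memLp_coord q 0).const_mul _) hφ2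
    have hH1 : ip (fun y => -grad θ v 0 y 0 + Complex.I * ω * q y 1) φ =
        -ip (fun y => grad θ v 0 y 0) φ + Complex.I * ω * ip (fun y => q y 1) φ := by
      rw [← ip_smul_left, ← ip_neg_left]
      exact ip_add_left (sqInt_grad θ v 0 0).neg ((memLp_coord q 1).const_mul _) hφ2
    have hM0 := ip_congr_left φ (hae.mono fun y hy => hy.1)
    have hM1 := ip_congr_left φ (hae.mono fun y hy => hy.2)
    rw [hH0, hε] at hM0
    rw [hH1, hε] at hM1
    intro i
    fin_cases i
    · simp [cellCurl, cellDeriv, hneg, hvD, hEip _ hφ2]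
      constructor
      · linear_combination hM0
      · linear_combination -ip (fun y => grad θ v 1 y 1) φ * hκ
    · simp [cellCurl, cellDeriv, hneg, hvD, hEip _ hφ2]
      constructor
      · linear_combination hM1
      · linear_combination ip (fun y => grad θ v 1 y 0) φ * hκ
    · simp [cellCurl, cellDeriv, hneg, hqD, hEip _ (hd _)]
      constructor
      · linear_combination -hdiv
      · linear_combination hcurl + κ * hcomm

/-! ### Extension from the cell to the plane -/

/-- The `z` for which `y` lies in the translate of the cell by `2π z`. -/
def cellIndex (y : Plane) : ℤ × ℤ :=
  (⌊(y.1 + Real.pi) / (2 * Real.pi)⌋, ⌊(y.2 + Real.pi) / (2 * Real.pi)⌋)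

lemma sub_latticeVec_mem_cell_iff {y : Plane} {z : ℤ × ℤ} :
    y - latticeVec z ∈ cell ↔ cellIndex y = z := by
  have hpi := Real.two_pi_pos
  have key : ∀ (t : ℝ) (m : ℤ), t - 2 * Real.pi * m ∈ Ico (-Real.pi) Real.pi ↔
      ⌊(t + Real.pi) / (2 * Real.pi)⌋ = m := by
    intro t m
    rw [Int.floor_eq_iff, le_div_iff₀ hpi, div_lt_iff₀ hpi, mem_Ico]
    constructor
    · rintro ⟨h1, h2⟩
      constructor <;> linarith
    · rintro ⟨h1, h2⟩
      constructor <;> linarith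
  rw [Prod.ext_iff]
  exact and_congr (key _ _) (key _ _)

lemma cellIndex_add_latticeVec (y : Plane) (z : ℤ × ℤ) :
    cellIndex (y + latticeVec z) = cellIndex y + z := by
  rw [← sub_latticeVec_mem_cell_iff, latticeVec_add, add_sub_add_right_eq_sub,
    sub_latticeVec_mem_cell_iff]

lemma latticeVec_zero : latticeVec 0 = 0 := by
  ext <;> simp [latticeVec]

lemma cellIndex_of_mem_cell {y : Plane} (hy : y ∈ cell) : cellIndex y = 0 := by
  rw [← sub_latticeVec_mem_cell_iff, latticeVec_zero, sub_zero]
  exact hy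

/-- The `θ`-quasi-periodic function agreeing with `f` on the cell. -/
def extend {F : Type*} [SMul ℂ F] (θ : Plane) (f : Plane → F) (y : Plane) : F :=
  phase θ (cellIndex y) • f (y - latticeVec (cellIndex y))

lemma extend_of_mem_cell {F : Type*} [AddCommGroup F] [Module ℂ F] (θ : Plane) (f : Plane → F)
    {y : Plane} (hy : y ∈ cell) : extend θ f y = f y := by
  simp [extend, cellIndex_of_mem_cell hy, latticeVec_zero, phase]

lemma quasiPeriodic_of_latticeVec {F : Type*} [AddCommGroup F] [Module ℂ F] {θ : Plane}
    {f : Plane → F} (h : ∀ z y, f (y + latticeVec z) = phase θ z • f y) : QuasiPeriodic θ f := by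
  intro y
  have h1 := h (1, 0) y
  have h2 := h (0, 1) y
  simp only [latticeVec, phase, Int.cast_one, Int.cast_zero, mul_one, mul_zero, add_zero,
    zero_add] at h1 h2
  exact ⟨h1, h2⟩

lemma quasiPeriodic_extend {F : Type*} [AddCommGroup F] [Module ℂ F] (θ : Plane) (f : Plane → F) :
    QuasiPeriodic θ (extend θ f) := by
  refine quasiPeriodic_of_latticeVec fun z y => ?_
  rw [extend, extend, cellIndex_add_latticeVec, latticeVec_add, add_sub_add_right_eq_sub,
    phase_add, mul_comm, mul_smul]

lemma finite_norm_latticeVec_le (M : ℝ) : {z : ℤ × ℤ | ‖latticeVec z‖ ≤ M}.Finite := by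
  obtain ⟨N, hN⟩ := exists_nat_gt M
  refine ((Set.finite_Icc (-(N : ℤ)) N).prod (Set.finite_Icc (-(N : ℤ)) N)).subset ?_
  intro z hz
  have key : ∀ m : ℤ, |2 * Real.pi * (m : ℝ)| ≤ M → m ∈ Set.Icc (-(N : ℤ)) N := by
    intro m hm
    have hpi := Real.pi_gt_three
    rw [abs_mul, abs_of_pos (by positivity : (0 : ℝ) < 2 * Real.pi)] at hm
    have h4 : |(m : ℝ)| ≤ N := by nlinarith [abs_nonneg (m : ℝ)]
    rw [abs_le] at h4
    exact ⟨by exact_mod_cast h4.1, by exact_mod_cast h4.2⟩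
  rw [Set.mem_ofPred_eq, Prod.norm_def, max_le_iff] at hz
  exact ⟨key _ hz.1, key _ hz.2⟩

lemma norm_le_pi_of_mem_cell {y : Plane} (hy : y ∈ cell) : ‖y‖ ≤ Real.pi := by
  rw [Prod.norm_def]
  exact max_le (abs_le.2 ⟨hy.1.1, hy.1.2.le⟩) (abs_le.2 ⟨hy.2.1, hy.2.2.le⟩)

/-- The translate of the cell by `2π z`. -/
def tile (z : ℤ × ℤ) : Set Plane := (fun y => y - latticeVec z) ⁻¹' cell

lemma mem_tile {y : Plane} {z : ℤ × ℤ} : y ∈ tile z ↔ cellIndex y = z := sub_latticeVec_mem_cell_iff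

lemma measurableSet_tile (z : ℤ × ℤ) : MeasurableSet (tile z) :=
  (measurable_sub_const _) measurableSet_cell

lemma pairwise_disjoint_tile : Pairwise (Function.onFun Disjoint tile) := by
  intro z w hzw
  refine Set.disjoint_left.2 fun y hz hw => hzw ?_
  rw [← mem_tile.1 hz, ← mem_tile.1 hw]

lemma iUnion_tile : ⋃ z, tile z = univ :=
  eq_univ_of_forall fun y => mem_iUnion.2 ⟨cellIndex y, mem_tile.2 rfl⟩

lemma measurePreserving_tile (z : ℤ × ℤ) : MeasurePreserving (fun y : Plane => y - latticeVec z)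
    (volume.restrict (tile z)) (volume.restrict cell) :=
  (measurePreserving_sub_right volume (latticeVec z)).restrict_preimage measurableSet_cell

lemma QuasiPeriodic.eq_phase_mul {θ : Plane} {A : Plane → ℂ} (hA : QuasiPeriodic θ A) (z : ℤ × ℤ)
    (y : Plane) : A y = phase θ z * A (y - latticeVec z) := by
  have h := hA.add_latticeVec z (y - latticeVec z)
  rwa [sub_add_cancel, smul_eq_mul] at h

lemma QuasiPeriodic.memLp_tile {θ : Plane} {A : Plane → ℂ} (hA : QuasiPeriodic θ A) (h : SqInt A)
    (z : ℤ × ℤ) : MemLp A 2 (volume.restrict (tile z)) := by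
  have h1 := (MemLp.comp_measurePreserving h (measurePreserving_tile z)).const_mul (phase θ z)
  refine h1.ae_eq (Filter.Eventually.of_forall fun y => ?_)
  exact (hA.eq_phase_mul z y).symm

lemma QuasiPeriodic.memLp_compact {θ : Plane} {A : Plane → ℂ} (hA : QuasiPeriodic θ A)
    (h : SqInt A) {K : Set Plane} (hK : IsCompact K) : MemLp A 2 (volume.restrict K) := by
  have hmeas : AEStronglyMeasurable A volume := by
    rw [← Measure.restrict_univ (μ := (volume : Measure Plane)), ← iUnion_tile,
      aestronglyMeasurable_iUnion_iff]
    exact fun z => (hA.memLp_tile h z).aestronglyMeasurable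
  rw [memLp_two_iff_integrable_sq_norm hmeas.restrict]
  obtain ⟨M, hM⟩ := hK.isBounded.exists_norm_le
  have hfin := finite_norm_latticeVec_le (M + Real.pi)
  have hsub : K ⊆ ⋃ z ∈ {z | ‖latticeVec z‖ ≤ M + Real.pi}, tile z := by
    intro y hy
    refine mem_iUnion₂.2 ⟨cellIndex y, ?_, mem_tile.2 rfl⟩
    have h1 := norm_le_pi_of_mem_cell (sub_latticeVec_mem_cell_iff.2 (rfl : cellIndex y = _))
    have h2 := norm_sub_le y (y - latticeVec (cellIndex y))
    rw [sub_sub_cancel] at h2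
    exact h2.trans (add_le_add (hM y hy) h1)
  have hint : IntegrableOn (fun y => ‖A y‖ ^ 2)
      (⋃ z ∈ {z | ‖latticeVec z‖ ≤ M + Real.pi}, tile z) :=
    (integrableOn_finite_biUnion hfin).2 fun z _ => (hA.memLp_tile h z).norm.integrable_sq
  exact hint.mono_set hsub

lemma QuasiPeriodic.locallyIntegrable {θ : Plane} {A : Plane → ℂ} (hA : QuasiPeriodic θ A)
    (h : SqInt A) : LocallyIntegrable A := by
  rw [locallyIntegrable_iff]
  intro K hK
  have : IsFiniteMeasure ((volume : Measure Plane).restrict K) :=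
    isFiniteMeasure_restrict.2 hK.measure_lt_top.ne
  exact (hA.memLp_compact h hK).integrable (by norm_num)

/-- Pairing a quasi-periodic function with a compactly supported function over the plane amounts
to pairing it over the cell with the quasi-periodisation. -/
lemma integral_mul_eq_ip_periodize {θ : Plane} {A χ : Plane → ℂ} (hA : QuasiPeriodic θ A)
    (h : SqInt A) (hχ : Continuous χ) (hc : HasCompactSupport χ) :
    ∫ y, A y * χ y = ip A (periodize θ fun y => conj (χ y)) := by
  obtain ⟨M, hM⟩ := hc.isCompact.isBounded.exists_norm_le
  -- the translates of the support of `χ` by lattice vectors outside `S` do not meet the cell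
  set S := (finite_norm_latticeVec_le (M + Real.pi)).toFinset with hS
  have hzero : ∀ z ∉ S, ∀ y ∈ cell, χ (y + latticeVec z) = 0 := by
    intro z hz y hy
    by_contra hne
    apply hz
    rw [hS, Set.Finite.mem_toFinset, Set.mem_ofPred_eq]
    have h1 := hM _ (subset_tsupport χ hne)
    have h2 := norm_sub_le (y + latticeVec z) y
    rw [add_sub_cancel_left] at h2
    exact h2.trans (add_le_add h1 (norm_le_pi_of_mem_cell hy))
  have hint : Integrable fun y => A y * χ y :=
    (hA.locallyIntegrable h).integrable_smul_right_of_hasCompactSupport hχ hc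
  have htile : ∀ z, ∫ y in tile z, A y * χ y =
      ∫ y in cell, A y * (phase θ z * χ (y + latticeVec z)) := by
    intro z
    have := (measurePreserving_tile z).integral_comp
      (MeasurableEquiv.subRight (latticeVec z)).measurableEmbedding
      (fun y => A (y + latticeVec z) * χ (y + latticeVec z))
    simp only [sub_add_cancel] at this
    rw [this]
    refine integral_congr_ae (Filter.Eventually.of_forall fun y => ?_)
    simp only [hA.add_latticeVec, smul_eq_mul]
    ring
  have htrans : ∀ z, SqInt fun y => conj (phase θ z * χ (y + latticeVec z)) := fun z =>
    memLp_of_continuous (by fun_prop)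
  have hper : ∀ y ∈ cell, conj (periodize θ (fun y => conj (χ y)) y) =
      ∑ z ∈ S, phase θ z * χ (y + latticeVec z) := by
    intro y hy
    have e : periodize θ (fun y => conj (χ y)) y =
        ∑ᶠ z, conj (phase θ z * χ (y + latticeVec z)) := by
      refine finsum_congr fun z => ?_
      rw [map_mul, conj_phase]
      rfl
    rw [e, finsum_eq_sum_of_support_subset (s := S), map_sum]
    · simp only [Complex.conj_conj]
    · intro z hz
      by_contra hzS
      refine hz ?_
      change conj (phase θ z * χ (y + latticeVec z)) = 0
      rw [hzero z (by simpa using hzS) y hy, mul_zero, map_zero]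
  rw [← setIntegral_univ, ← iUnion_tile, integral_iUnion measurableSet_tile pairwise_disjoint_tile
    hint.integrableOn, tsum_congr htile, tsum_eq_sum (s := S)]
  · rw [← integral_finsetSum]
    · refine setIntegral_congr_fun measurableSet_cell fun y hy => ?_
      simp only [hper y hy, Finset.mul_sum]
    · intro z _
      simpa using integrable_mul_conj h (htrans z)
  · intro z hz
    rw [← integral_zero Plane ℂ (μ := volume.restrict cell)]
    refine setIntegral_congr_fun measurableSet_cell fun y hy => ?_
    simp only [hzero z hz y hy, mul_zero]

lemma fderiv_periodize (θ : Plane) {ψ : Plane → ℂ} (hψ : ContDiff ℝ (⊤ : ℕ∞) ψ)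
    (hc : HasCompactSupport ψ) (y e : Plane) :
    fderiv ℝ (periodize θ ψ) y e = periodize θ (fun y => fderiv ℝ ψ y e) y := by
  set c : ℤ × ℤ → ℂ :=
    fun z => Complex.exp (-(2 * Real.pi * Complex.I * (θ.1 * z.1 + θ.2 * z.2))) with hcdef
  -- near `y` only the finitely many translates with index in `S` contribute
  obtain ⟨U, hU, hfin⟩ := locallyFinite_translates hc c y
  set S := hfin.toFinset with hS
  have hout : ∀ z ∉ S, ∀ x ∈ U, ψ (x + latticeVec z) = 0 := by
    intro z hz x hx
    by_contra hne
    apply hz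
    rw [hS, Set.Finite.mem_toFinset]
    exact ⟨x, mul_ne_zero (Complex.exp_ne_zero _) hne, hx⟩
  have hev : periodize θ ψ =ᶠ[nhds y] fun x => ∑ z ∈ S, c z * ψ (x + latticeVec z) := by
    filter_upwards [hU] with x hx
    refine finsum_eq_sum_of_support_subset _ fun z hz => ?_
    by_contra hzS
    refine hz ?_
    change c z * ψ (x + latticeVec z) = 0
    rw [hout z (by simpa using hzS) x hx, mul_zero]
  have hd : ∀ z, HasFDerivAt (fun x => c z * ψ (x + latticeVec z))
      (c z • fderiv ℝ ψ (y + latticeVec z)) y := fun z => by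
    have h1 := (hψ.differentiable (by simp) (y + latticeVec z)).hasFDerivAt
    exact ((hasFDerivAt_comp_add_right (latticeVec z)).2 h1).const_mul (c z)
  have hsum : HasFDerivAt (fun x => ∑ z ∈ S, c z * ψ (x + latticeVec z))
      (∑ z ∈ S, c z • fderiv ℝ ψ (y + latticeVec z)) y := HasFDerivAt.fun_sum fun z _ => hd z
  rw [hev.fderiv_eq, hsum.fderiv, _root_.sum_apply]
  symm
  refine finsum_eq_sum_of_support_subset _ fun z hz => ?_
  by_contra hzS
  refine hz ?_
  change c z * fderiv ℝ ψ (y + latticeVec z) e = 0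
  have h0 : (fun x => ψ (x + latticeVec z)) =ᶠ[nhds y] fun _ => 0 := by
    filter_upwards [hU] with x hx
    exact hout z (by simpa using hzS) x hx
  rw [← fderiv_comp_add_right, h0.fderiv_eq]
  simp

/-- The smooth `θ`-quasi-periodic test function on the cell induced by a test function `χ` on the
plane; pairings are sesquilinear, whence the conjugation. -/
def cellTest (θ : Plane) (χ : Plane → ℂ) : Plane → ℂ := periodize θ fun y => conj (χ y)

lemma contDiff_cellTest (θ : Plane) {χ : Plane → ℂ} (hχ : ContDiff ℝ (⊤ : ℕ∞) χ)
    (hc : HasCompactSupport χ) : ContDiff ℝ (⊤ : ℕ∞) (cellTest θ χ) :=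
  contDiff_periodize θ (Complex.conjCLE.contDiff.comp hχ) (hc.comp_left (map_zero _))

lemma integral_mul_eq_ip {θ : Plane} {A χ : Plane → ℂ} (hA : QuasiPeriodic θ A)
    (h : SqInt A) (hχ : ContDiff ℝ (⊤ : ℕ∞) χ) (hc : HasCompactSupport χ) :
    ∫ y, A y * χ y = ip A (cellTest θ χ) :=
  integral_mul_eq_ip_periodize hA h hχ.continuous hc

lemma integral_mul_fderiv_eq_ip {θ : Plane} {A χ : Plane → ℂ} (hA : QuasiPeriodic θ A)
    (h : SqInt A) (hχ : ContDiff ℝ (⊤ : ℕ∞) χ) (hc : HasCompactSupport χ) (e : Plane) :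
    ∫ y, A y * fderiv ℝ χ y e = ip A fun y => fderiv ℝ (cellTest θ χ) y e := by
  rw [integral_mul_eq_ip_periodize hA h
    ((hχ.continuous_fderiv (by simp)).clm_apply continuous_const) (hc.fderiv_apply (𝕜 := ℝ) e)]
  congr 1
  ext y
  refine Eq.trans ?_ (fderiv_periodize θ (ψ := fun y => conj (χ y))
    (Complex.conjCLE.contDiff.comp hχ) (hc.comp_left (map_zero _)) y e).symm
  congr 1
  ext x
  have h1 : HasFDerivAt (fun y => conj (χ y))
      ((Complex.conjCLE : ℂ →L[ℝ] ℂ).comp (fderiv ℝ χ x)) x :=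
    (Complex.conjCLE : ℂ →L[ℝ] ℂ).hasFDerivAt.comp x
      (hχ.differentiable (by simp) x).hasFDerivAt
  rw [h1.fderiv]
  rfl

lemma Fibre.permittivity_add_latticeVec (P : Fibre) (y : Plane) (z : ℤ × ℤ) :
    P.permittivity (y + latticeVec z) = P.permittivity y := by
  have hiff : (∃ w, y + latticeVec z - latticeVec w ∈ P.R) ↔ ∃ w, y - latticeVec w ∈ P.R := by
    constructor
    · rintro ⟨w, hw⟩
      refine ⟨w - z, ?_⟩
      have h := latticeVec_add (w - z) z
      rw [sub_add_cancel] at h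
      rwa [h, add_sub_add_right_eq_sub] at hw
    · rintro ⟨w, hw⟩
      exact ⟨w + z, by rwa [latticeVec_add, add_sub_add_right_eq_sub]⟩
  unfold Fibre.permittivity
  by_cases h : ∃ w, y - latticeVec w ∈ P.R
  · exact (if_pos (hiff.2 h)).trans (if_pos h).symm
  · exact (if_neg (mt hiff.1 h)).trans (if_neg h).symm

lemma Fibre.quasiPeriodic_permittivity_mul (P : Fibre) {θ : Plane} {A : Plane → ℂ}
    (hA : QuasiPeriodic θ A) : QuasiPeriodic θ fun y => P.permittivity y * A y := by
  refine quasiPeriodic_of_latticeVec fun z y => ?_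
  rw [P.permittivity_add_latticeVec, hA.add_latticeVec, smul_eq_mul, smul_eq_mul]
  ring

/-! ### Waves in space-time -/

/-- The factor `exp (i ω (x₃ - t))` of the wave. -/
def carrier (ω : ℝ) (s : ℝ × ℝ) : ℂ := Complex.exp (Complex.I * ω * ((1 : ℝ) * s.1 - s.2))

lemma planeWave_one_apply (ω : ℝ) (A : Plane → Fin 3 → ℂ) (p : SpaceTime) (i : Fin 3) :
    planeWave ω 1 A p i = carrier ω p.2 * A p.1 i := rfl

lemma hasFDerivAt_carrier (ω : ℝ) (s : ℝ × ℝ) :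
    HasFDerivAt (carrier ω) (carrier ω s • (Complex.I * ω) •
      (((1 : ℝ) : ℂ) • Complex.ofRealCLM.comp (ContinuousLinearMap.fst ℝ ℝ ℝ) -
        Complex.ofRealCLM.comp (ContinuousLinearMap.snd ℝ ℝ ℝ))) s := by
  have h1 : HasFDerivAt (fun y : ℝ × ℝ => (y.1 : ℂ))
      (Complex.ofRealCLM.comp (ContinuousLinearMap.fst ℝ ℝ ℝ)) s :=
    (Complex.ofRealCLM.comp (ContinuousLinearMap.fst ℝ ℝ ℝ)).hasFDerivAt
  have h2 : HasFDerivAt (fun y : ℝ × ℝ => (y.2 : ℂ))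
      (Complex.ofRealCLM.comp (ContinuousLinearMap.snd ℝ ℝ ℝ)) s :=
    (Complex.ofRealCLM.comp (ContinuousLinearMap.snd ℝ ℝ ℝ)).hasFDerivAt
  exact (((h1.const_mul ((1 : ℝ) : ℂ)).sub h2).const_mul (Complex.I * ω)).cexp

lemma continuous_carrier (ω : ℝ) : Continuous (carrier ω) :=
  continuous_iff_continuousAt.2 fun s => (hasFDerivAt_carrier ω s).continuousAt

lemma fderiv_carrier (ω : ℝ) (s e : ℝ × ℝ) :
    fderiv ℝ (carrier ω) s e = Complex.I * ω * (e.1 - e.2) * carrier ω s := by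
  rw [(hasFDerivAt_carrier ω s).fderiv]
  simp
  ring

lemma integrableOn_wave {A : Plane → ℂ} (hA : LocallyIntegrable A) (ω : ℝ) {K : Set SpaceTime}
    (hK : IsCompact K) : IntegrableOn (fun p : SpaceTime => carrier ω p.2 * A p.1) K := by
  have hK1 : IsCompact (Prod.fst '' K) := hK.image continuous_fst
  have hK2 : IsCompact (Prod.snd '' K) := hK.image continuous_snd
  have : IsFiniteMeasure ((volume : Measure (ℝ × ℝ)).restrict (Prod.snd '' K)) :=
    isFiniteMeasure_restrict.2 hK2.measure_lt_top.ne
  have h1 : IntegrableOn (fun p : SpaceTime => A p.1) ((Prod.fst '' K) ×ˢ (Prod.snd '' K)) := by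
    rw [IntegrableOn, Measure.volume_eq_prod, ← Measure.prod_restrict]
    exact Integrable.comp_fst (hA.integrableOn_isCompact hK1) _
  have h2 : IntegrableOn (fun p : SpaceTime => A p.1) K :=
    h1.mono_set fun p hp => ⟨mem_image_of_mem _ hp, mem_image_of_mem _ hp⟩
  exact h2.continuousOn_mul ((continuous_carrier ω).comp continuous_snd).continuousOn hK

lemma integrable_wave_mul {A : Plane → ℂ} (hA : LocallyIntegrable A) (ω : ℝ) {g : SpaceTime → ℂ}
    (hg : Continuous g) (hc : HasCompactSupport g) :
    Integrable fun p : SpaceTime => carrier ω p.2 * A p.1 * g p := by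
  have h : LocallyIntegrable fun p : SpaceTime => carrier ω p.2 * A p.1 :=
    locallyIntegrable_iff.2 fun K hK => integrableOn_wave hA ω hK
  exact h.integrable_smul_right_of_hasCompactSupport hg hc

lemma locallyIntegrable_planeWave {A : Plane → Fin 3 → ℂ}
    (hA : ∀ i, LocallyIntegrable fun y => A y i) (ω : ℝ) :
    LocallyIntegrable (planeWave ω 1 A) :=
  locallyIntegrable_iff.2 fun _ hK => Integrable.of_eval fun i => integrableOn_wave (hA i) ω hK

/-- Fubini's theorem for a wave: the amplitude is integrated first. -/
lemma integral_wave_mul {A : Plane → ℂ} (hA : LocallyIntegrable A) (ω : ℝ) {g : SpaceTime → ℂ}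
    (hg : Continuous g) (hc : HasCompactSupport g) :
    Integrable (fun s => carrier ω s * ∫ y, A y * g (y, s)) ∧
      ∫ p : SpaceTime, carrier ω p.2 * A p.1 * g p =
        ∫ s, carrier ω s * ∫ y, A y * g (y, s) := by
  have hint := integrable_wave_mul hA ω hg hc
  have e : ∀ s : ℝ × ℝ, ∫ y : Plane, carrier ω s * A y * g (y, s) =
      carrier ω s * ∫ y, A y * g (y, s) := by
    intro s
    rw [← integral_const_mul]
    simp only [mul_assoc]
  rw [Measure.volume_eq_prod Plane (ℝ × ℝ)] at hint ⊢
  have h1 := hint.integral_prod_right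
  rw [integral_prod_symm _ hint]
  simp only [e] at h1 ⊢
  exact ⟨h1, trivial⟩

/-- The section of a test function on space-time at fixed `(x₃, t)`. -/
def slice (ψ : SpaceTime → ℂ) (s : ℝ × ℝ) (y : Plane) : ℂ := ψ (y, s)

lemma contDiff_slice {ψ : SpaceTime → ℂ} (hψ : ContDiff ℝ (⊤ : ℕ∞) ψ) (s : ℝ × ℝ) :
    ContDiff ℝ (⊤ : ℕ∞) (slice ψ s) := hψ.comp (contDiff_id.prodMk contDiff_const)

lemma hasCompactSupport_slice {ψ : SpaceTime → ℂ} (hc : HasCompactSupport ψ) (s : ℝ × ℝ) :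
    HasCompactSupport (slice ψ s) := by
  refine HasCompactSupport.intro (hc.isCompact.image continuous_fst) fun y hy => ?_
  by_contra hne
  exact hy ⟨(y, s), subset_tsupport ψ hne, rfl⟩

lemma fderiv_slice {ψ : SpaceTime → ℂ} (hψ : ContDiff ℝ (⊤ : ℕ∞) ψ) (s : ℝ × ℝ) (y e : Plane) :
    fderiv ℝ (slice ψ s) y e = fderiv ℝ ψ (y, s) (e, 0) := by
  have h : HasFDerivAt (slice ψ s) _ y :=
    (hψ.differentiable (by simp) (y, s)).hasFDerivAt.comp y (hasFDerivAt_prodMk_left y s)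
  rw [h.fderiv]
  simp

/-- Integration by parts in `(x₃, t)`. -/
lemma integral_carrier_mul_fderiv (ω : ℝ) {ψ : SpaceTime → ℂ} (hψ : ContDiff ℝ (⊤ : ℕ∞) ψ)
    (hc : HasCompactSupport ψ) (y : Plane) (e : ℝ × ℝ) :
    ∫ s, carrier ω s * fderiv ℝ ψ (y, s) (0, e) =
      -(Complex.I * ω * (e.1 - e.2)) * ∫ s, carrier ω s * ψ (y, s) := by
  have hcont : Continuous fun s => ψ (y, s) := hψ.continuous.comp (by fun_prop)
  have hcs : HasCompactSupport fun s => ψ (y, s) := by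
    refine HasCompactSupport.intro (hc.isCompact.image continuous_snd) fun s hs => ?_
    by_contra hne
    exact hs ⟨(y, s), subset_tsupport ψ hne, rfl⟩
  have hd : ∀ s, HasFDerivAt (fun s => ψ (y, s))
      ((fderiv ℝ ψ (y, s)).comp (ContinuousLinearMap.inr ℝ Plane (ℝ × ℝ))) s := fun s =>
    (hψ.differentiable (by simp) (y, s)).hasFDerivAt.comp s (hasFDerivAt_prodMk_right y s)
  have hfd : ∀ s, fderiv ℝ (fun s => ψ (y, s)) s e = fderiv ℝ ψ (y, s) (0, e) := fun s => by
    rw [(hd s).fderiv]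
    simp
  have hcontd : Continuous fun s => fderiv ℝ (fun s => ψ (y, s)) s e := by
    simp only [hfd]
    exact ((hψ.continuous_fderiv (by simp)).comp (by fun_prop)).clm_apply continuous_const
  have hε := continuous_carrier ω
  have hI : ∀ {a b : ℝ × ℝ → ℂ}, Continuous a → Continuous b → HasCompactSupport b →
      Integrable fun s => a s * b s := fun ha hb hbc =>
    (ha.mul hb).integrable_of_hasCompactSupport hbc.mul_left
  have h := integral_mul_fderiv_eq_neg_fderiv_mul_of_integrable (μ := volume) (f := carrier ω)
    (g := fun s => ψ (y, s)) (v := e)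
    (hI (by simp only [fderiv_carrier]; fun_prop) hcont hcs)
    (hI hε hcontd (hcs.fderiv_apply (𝕜 := ℝ) e)) (hI hε hcont hcs)
    (fun s _ => (hasFDerivAt_carrier ω s).differentiableAt)
    (fun s _ => (hd s).differentiableAt)
  simp only [hfd] at h
  rw [h, ← integral_const_mul, ← integral_neg]
  congr 1
  ext s
  rw [fderiv_carrier]
  ring

/-- Derivatives of a wave in the directions of `x₃` and `t` multiply it by `± i ω`. -/
lemma distDeriv_wave_snd {A : Plane → ℂ} (hA : LocallyIntegrable A) (ω : ℝ) {ψ : SpaceTime → ℂ}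
    (hψ : ContDiff ℝ (⊤ : ℕ∞) ψ) (hc : HasCompactSupport ψ) (e : ℝ × ℝ) :
    distDeriv (0, e) (fun p => carrier ω p.2 * A p.1) ψ =
      ∫ s, carrier ω s * (Complex.I * ω * (e.1 - e.2) * ∫ y, A y * slice ψ s y) := by
  have h1 : Integrable fun p : SpaceTime => carrier ω p.2 * A p.1 * fderiv ℝ ψ p (0, e) :=
    integrable_wave_mul hA ω ((hψ.continuous_fderiv (by simp)).clm_apply continuous_const)
      (hc.fderiv_apply (𝕜 := ℝ) _)
  have h2 : Integrable fun p : SpaceTime => carrier ω p.2 * A p.1 * ψ p :=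
    integrable_wave_mul hA ω hψ.continuous hc
  have h3 := (integral_wave_mul hA ω hψ.continuous hc).2
  have e1 : ∀ y, ∫ s, carrier ω s * A y * fderiv ℝ ψ (y, s) (0, e) =
      -(Complex.I * ω * (e.1 - e.2)) * ∫ s, carrier ω s * A y * ψ (y, s) := by
    intro y
    have := congrArg (A y * ·) (integral_carrier_mul_fderiv ω hψ hc y e)
    rw [mul_left_comm, ← integral_const_mul, ← integral_const_mul] at this
    simp only [mul_comm (A y)] at this
    simp only [mul_right_comm _ (A y)]
    exact this
  have h4 : ∫ p : SpaceTime, carrier ω p.2 * A p.1 * fderiv ℝ ψ p (0, e) =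
      -(Complex.I * ω * (e.1 - e.2)) * ∫ p : SpaceTime, carrier ω p.2 * A p.1 * ψ p := by
    rw [Measure.volume_eq_prod Plane (ℝ × ℝ)] at h1 h2 ⊢
    rw [integral_prod _ h1, integral_prod _ h2, ← integral_const_mul]
    simp only [e1]
  rw [distDeriv, h4, h3, neg_mul, neg_neg, ← integral_const_mul]
  congr 1
  ext s
  simp only [slice]
  ring

/-- The distributional derivatives of a wave with quasi-periodic amplitude, in terms of the cell. -/
lemma distDeriv_wave_space {θ : Plane} {A : Plane → ℂ} (hA : QuasiPeriodic θ A) (h : SqInt A)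
    (ω : ℝ) {ψ : SpaceTime → ℂ} (hψ : ContDiff ℝ (⊤ : ℕ∞) ψ) (hc : HasCompactSupport ψ)
    (j : Fin 3) :
    Integrable (fun s => carrier ω s * cellDeriv ω j A (cellTest θ (slice ψ s))) ∧
    distDeriv (spaceDir j) (fun p => carrier ω p.2 * A p.1) ψ =
      ∫ s, carrier ω s * cellDeriv ω j A (cellTest θ (slice ψ s)) := by
  have hloc := hA.locallyIntegrable h
  have hplane : ∀ e : Plane,
      Integrable (fun s => carrier ω s *
        -ip A (fun y => fderiv ℝ (cellTest θ (slice ψ s)) y e)) ∧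
      distDeriv (e, 0) (fun p => carrier ω p.2 * A p.1) ψ =
        ∫ s, carrier ω s * -ip A (fun y => fderiv ℝ (cellTest θ (slice ψ s)) y e) := by
    intro e
    have h1 := integral_wave_mul hloc ω (g := fun p => fderiv ℝ ψ p (e, 0))
      ((hψ.continuous_fderiv (by simp)).clm_apply continuous_const) (hc.fderiv_apply (𝕜 := ℝ) _)
    have e1 : ∀ s, ∫ y, A y * fderiv ℝ ψ (y, s) (e, 0) =
        ip A fun y => fderiv ℝ (cellTest θ (slice ψ s)) y e := fun s => by
      rw [← integral_mul_fderiv_eq_ip hA h (contDiff_slice hψ s) (hasCompactSupport_slice hc s)]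
      simp only [fderiv_slice hψ]
    simp only [e1] at h1
    simp only [mul_neg]
    refine ⟨h1.1.neg, ?_⟩
    rw [distDeriv, h1.2, integral_neg]
  fin_cases j
  · exact hplane (axis 0)
  · exact hplane (axis 1)
  · have h1 := (integral_wave_mul hloc ω hψ.continuous hc).1.const_mul (Complex.I * ω)
    have h2 := distDeriv_wave_snd hloc ω hψ hc (1, 0)
    have e1 : ∀ s, ∫ y, A y * ψ (y, s) = ip A (cellTest θ (slice ψ s)) := fun s =>
      integral_mul_eq_ip hA h (contDiff_slice hψ s) (hasCompactSupport_slice hc s)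
    simp only [slice] at h2
    simp only [e1] at h1 h2
    refine ⟨h1.congr (Filter.Eventually.of_forall fun s => ?_), h2.trans ?_⟩
    · simp [cellDeriv]
      ring
    · simp [cellDeriv]

lemma distDeriv_wave_time {θ : Plane} {A : Plane → ℂ} (hA : QuasiPeriodic θ A) (h : SqInt A)
    (ω : ℝ) {ψ : SpaceTime → ℂ} (hψ : ContDiff ℝ (⊤ : ℕ∞) ψ) (hc : HasCompactSupport ψ) :
    distDeriv timeDir (fun p => carrier ω p.2 * A p.1) ψ =
      ∫ s, carrier ω s * (-(Complex.I * ω) * ip A (cellTest θ (slice ψ s))) := by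
  refine (distDeriv_wave_snd (hA.locallyIntegrable h) ω hψ hc (0, 1)).trans ?_
  congr 1
  ext s
  rw [integral_mul_eq_ip hA h (contDiff_slice hψ s) (hasCompactSupport_slice hc s)]
  simp

lemma distCurl_planeWave {θ : Plane} {A : Plane → Fin 3 → ℂ} (hA : QuasiPeriodic θ A)
    (h : ∀ i, SqInt fun y => A y i) (ω : ℝ) {ψ : SpaceTime → ℂ} (hψ : ContDiff ℝ (⊤ : ℕ∞) ψ)
    (hc : HasCompactSupport ψ) (i : Fin 3) :
    distCurl (planeWave ω 1 A) i ψ =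
      ∫ s, carrier ω s * cellCurl ω A i (cellTest θ (slice ψ s)) := by
  have hAi : ∀ i, QuasiPeriodic θ fun y => A y i := fun i y =>
    ⟨congrFun (hA y).1 i, congrFun (hA y).2 i⟩
  have h1 := distDeriv_wave_space (hAi (i + 2)) (h (i + 2)) ω hψ hc (i + 1)
  have h2 := distDeriv_wave_space (hAi (i + 1)) (h (i + 1)) ω hψ hc (i + 2)
  simp only [distCurl, planeWave_one_apply, cellCurl, mul_sub]
  rw [h1.2, h2.2, integral_sub h1.1 h2.1]

/-- Quasi-periodic amplitudes that solve the time-harmonic Maxwell system on the cell give waves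
solving the Maxwell system in space-time. -/
lemma Fibre.IsCellSolution.isMaxwellSolution {P : Fibre} {θ : Plane} {ω : ℝ}
    {E H : Plane → Fin 3 → ℂ} (h : P.IsCellSolution θ ω E H) (hE : QuasiPeriodic θ E)
    (hH : QuasiPeriodic θ H) : P.IsMaxwellSolution (planeWave ω 1 E) (planeWave ω 1 H) := by
  have hEi : ∀ i, QuasiPeriodic θ fun y => E y i := fun i y =>
    ⟨congrFun (hE y).1 i, congrFun (hE y).2 i⟩
  have hHi : ∀ i, QuasiPeriodic θ fun y => H y i := fun i y =>
    ⟨congrFun (hH y).1 i, congrFun (hH y).2 i⟩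
  obtain ⟨hE2, hH2, heq⟩ := h
  refine ⟨locallyIntegrable_planeWave (fun i => (hEi i).locallyIntegrable (hE2 i)) ω,
    locallyIntegrable_planeWave (fun i => (hHi i).locallyIntegrable (hH2 i)) ω, ?_⟩
  intro ψ hψ hc i
  have hs := fun s => heq (cellTest θ (slice ψ s))
    (contDiff_cellTest θ (contDiff_slice hψ s) (hasCompactSupport_slice hc s))
    (quasiPeriodic_periodize θ _) i
  constructor
  · have e : (fun p : SpaceTime => (P.permittivity p.1 : ℂ) * planeWave ω 1 E p i) =
        fun p => carrier ω p.2 * (P.permittivity p.1 * E p.1 i) := by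
      ext p
      rw [planeWave_one_apply]
      ring
    rw [e, distCurl_planeWave hH hH2 ω hψ hc i,
      distDeriv_wave_time (P.quasiPeriodic_permittivity_mul (hEi i))
        (P.sqInt_permittivity_mul (hE2 i)) ω hψ hc, ← integral_neg]
    congr 1
    ext s
    rw [(hs s).1]
    ring
  · simp only [planeWave_one_apply]
    rw [distCurl_planeWave hE hE2 ω hψ hc i, distDeriv_wave_time (hHi i) (hH2 i) ω hψ hc]
    congr 1
    ext s
    rw [(hs s).2]

/-- Being a solution on the cell only depends on the values in the cell. -/
lemma Fibre.IsCellSolution.congr {P : Fibre} {θ : Plane} {ω : ℝ} {E H E' H' : Plane → Fin 3 → ℂ}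
    (h : P.IsCellSolution θ ω E H) (hE : ∀ y ∈ cell, E y = E' y) (hH : ∀ y ∈ cell, H y = H' y) :
    P.IsCellSolution θ ω E' H' := by
  have key : ∀ {F F' : Plane → Fin 3 → ℂ}, (∀ y ∈ cell, F y = F' y) → ∀ i,
      ∀ᵐ y ∂volume.restrict cell, F y i = F' y i := by
    intro F F' hF i
    filter_upwards [ae_restrict_mem measurableSet_cell] with y hy
    rw [hF y hy]
  have hcurl : ∀ {F F' : Plane → Fin 3 → ℂ}, (∀ y ∈ cell, F y = F' y) → ∀ i φ,
      cellCurl ω F i φ = cellCurl ω F' i φ := by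
    intro F F' hF i φ
    simp only [cellCurl, cellDeriv, ip_congr_left _ (key hF _)]
  refine ⟨fun i => (h.1 i).congr (key hE i), fun i => (h.2.1 i).congr (key hH i), ?_⟩
  intro φ hφ hq i
  have h3 := h.2.2 φ hφ hq i
  have hε : ∀ᵐ y ∂volume.restrict cell,
      (P.permittivity y : ℂ) * E y i = P.permittivity y * E' y i := by
    filter_upwards [key hE i] with y hy
    rw [hy]
  rwa [hcurl hE, hcurl hH, ip_congr_left _ hε, ip_congr_left _ (key hH i)] at h3

lemma Fibre.exists_isCellSolution_of_isEigenpair (P : Fibre) {θ : Plane} (hθ : θ ∈ dualCell)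
    {ω : ℝ} {v : P.Hsp θ} (hv : IsEigenpair (P.B θ) ((ω : ℂ) ^ 2) v) :
    ∃ E H : Plane → Fin 3 → ℂ, (∀ y, H y 2 = (v : L2) y 0 ∧ E y 2 = (v : L2) y 1) ∧
      P.IsCellSolution θ ω E H := by
  obtain ⟨-, hx, hBv⟩ := hv
  have hgraph : (v, ((ω : ℂ) ^ 2) • v) ∈ P.graphB θ := by
    rw [← P.graph_B, ← hBv]
    exact (P.B θ).mem_graph ⟨v, hx⟩
  obtain ⟨hV, hb⟩ := hgraph
  have hb' : ∀ φ ∈ P.V θ, P.b θ v φ = (ω : ℂ) ^ 2 * P.c v φ := by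
    intro φ hφ
    rw [← P.c_smul]
    exact hb φ hφ
  by_cases hω : ω = 0
  · subst hω
    exact P.exists_isCellSolution_zero hV fun φ hφ => by rw [hb' φ hφ]; simp
  · exact P.exists_isCellSolution hθ hω hV hb'

end PCF

end

theorem mainTheorem9 (P : PCF.Fibre) (θ : PCF.Plane) (hθ : θ ∈ PCF.dualCell) (ω : ℝ)
    (v : P.Hsp θ) (hv : PCF.IsEigenpair (P.B θ) ((ω : ℂ) ^ 2) v) :
    ∃ E H : PCF.Plane → Fin 3 → ℂ,
      PCF.IsLocallyL2 E ∧ PCF.IsLocallyL2 H ∧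
      PCF.QuasiPeriodic θ E ∧ PCF.QuasiPeriodic θ H ∧
      (∀ᵐ y ∂MeasureTheory.volume.restrict PCF.cell,
        H y 2 = (v : PCF.L2) y 0 ∧ E y 2 = (v : PCF.L2) y 1) ∧
      P.IsMaxwellSolution (PCF.planeWave ω 1 E) (PCF.planeWave ω 1 H) := by
  obtain ⟨E, H, hEH, hsol⟩ := P.exists_isCellSolution_of_isEigenpair hθ hv
  have hE := PCF.quasiPeriodic_extend θ E
  have hH := PCF.quasiPeriodic_extend θ H
  have hsol' : P.IsCellSolution θ ω (PCF.extend θ E) (PCF.extend θ H) :=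
    hsol.congr (fun y hy => (PCF.extend_of_mem_cell θ E hy).symm)
      fun y hy => (PCF.extend_of_mem_cell θ H hy).symm
  refine ⟨PCF.extend θ E, PCF.extend θ H, ?_, ?_, hE, hH, ?_, hsol'.isMaxwellSolution hE hH⟩
  · intro K hK
    exact MemLp.of_eval fun i => PCF.QuasiPeriodic.memLp_compact (A := fun y => PCF.extend θ E y i)
      (fun y => ⟨congrFun (hE y).1 i, congrFun (hE y).2 i⟩) (hsol'.1 i) hK
  · intro K hK
    exact MemLp.of_eval fun i => PCF.QuasiPeriodic.memLp_compact (A := fun y => PCF.extend θ H y i)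
      (fun y => ⟨congrFun (hH y).1 i, congrFun (hH y).2 i⟩) (hsol'.2.1 i) hK
  · filter_upwards [ae_restrict_mem PCF.measurableSet_cell] with y hy
    rw [PCF.extend_of_mem_cell θ E hy, PCF.extend_of_mem_cell θ H hy]
    exact hEH y
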